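/- Let $n\ge 0$, let $V\subseteq\mathbb R^n\times\mathbb R$ be open, and consider the second-order jet coordinates of a scalar field over $V$: $(x^\mu,\psi)\in V$, $\psi_\mu\in\mathbb R$, and $\psi_{\mu\nu}=\psi_{\nu\mu}\in\mathbb R$ ($\mu,\nu\in\{1,\dots,n\}$), where $\psi_\mu$ and $\psi_{\mu\nu}$ $(\mu\le\nu)$ are unrestricted independent variables. Put $\partial^{\mu\mu}=\partial/\partial\psi_{\mu\mu}$ and $\partial^{\mu\nu}=\tfrac12\,\partial/\partial\psi_{\mu\nu}$ for $\mu\neq\nu$. Let $\varepsilon^{\rho_1,\dots,\rho_n}$ be the totally antisymmetric symbol with $\varepsilon^{1,\dots,n}=1$; repeated indices are summed. For $r=0,\dots,n$ define the hyper-Jacobians $$J^{\rho_{r+1},\dots,\rho_n}_{\sigma_1,\dots,\sigma_r}=\varepsilon^{\rho_1,\dots,\rho_n}\prod_{i=1}^r\psi_{\rho_i\sigma_i}.$$ Let $\mathcal L$ be a smooth real function of $(x^\mu,\psi,\psi_\mu,\psi_{\mu\nu})$ on this domain. Then $\mathcal L$ satisfies $$\partial^{\mu\rho_1}\partial^{\rho_2\rho_3}\mathcal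 L+\partial^{\mu\rho_2}\partial^{\rho_3\rho_1}\mathcal L+\partial^{\mu\rho_3}\partial^{\rho_1\rho_2}\mathcal L=0\qquad\text{for all }\mu,\rho_1,\rho_2,\rho_3$$ if and only if $$\mathcal L=\sum_{r=0}^n\mathcal L^{\sigma_1,\dots,\sigma_r}_{\rho_{r+1},\dots,\rho_n}\,J^{\rho_{r+1},\dots,\rho_n}_{\sigma_1,\dots,\sigma_r}$$ for some smooth functions $\mathcal L^{\sigma_1,\dots,\sigma_r}_{\rho_{r+1},\dots,\rho_n}$ on the same domain which (a) are independent of the second derivatives: $\partial^{\mu\nu}\mathcal L^{\sigma_1,\dots,\sigma_r}_{\rho_{r+1},\dots,\rho_n}=0$ for all $\mu,\nu$ and $r=0,\dots,n$; (b) are antisymmetric in the upper and in the lower indices: $\mathcal L^{\sigma_{P(1)},\dots,\sigma_{P(r)}}_{\rho_{Q(r+1)},\dots,\rho_{Q(n)}}=(-1)^{|P|+|Q|}\mathcal L^{\sigma_1,\dots,\sigma_r}_{\rho_{r+1},\dots,\rho_n}$ for all permutations $P$ of $\{1,\dots,r\}$ and $Q$ of $\{r+1,\dots,n\}$, $r=0,\dots,n$;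 (c) are traceless: $\mathcal L^{\sigma_1,\dots,\sigma_{r-1},\zeta}_{\rho_{r+1},\dots,\rho_{n-1},\zeta}=0$ (summed over $\zeta$) for $r=1,\dots,n-1$. Moreover, the functions $\mathcal L^{\sigma_1,\dots,\sigma_r}_{\rho_{r+1},\dots,\rho_n}$ satisfying these conditions are uniquely determined by $\mathcal L$. -/

import Mathlib

open scoped ContDiff

namespace TrivialLagrangian

noncomputable section

/-- Second order jets of a scalar field in an adapted chart: the coordinates are
`((x^μ, ψ), ψ_μ, ψ_{μν})`. The second derivatives are indexed by unordered pairs of indices,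
so that `ψ_{μν} = ψ_{νμ}` and the `ψ_{μν}`, `μ ≤ ν`, are independent coordinates. -/
abbrev Jet2 (n : ℕ) : Type :=
  ((Fin n → ℝ) × ℝ) × (Fin n → ℝ) × (Sym2 (Fin n) → ℝ)

/-- The part of the second order jet space that lies over the chart domain `V`, where `V` is a set
of points `(x, ψ)`; the derivative coordinates are unrestricted. -/
def jetDomain {n : ℕ} (V : Set ((Fin n → ℝ) × ℝ)) : Set (Jet2 n) :=
  {p | p.1 ∈ V}

/-- The second derivative coordinate `ψ_{μν}` of a jet. -/
def psi2 {n : ℕ} (μ ν : Fin n) (p : Jet2 n) : ℝ :=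
  p.2.2 s(μ, ν)

/-- The operator `∂^{μν}`: the partial derivative with respect to the coordinate `ψ_{μν}`, times
the combinatorial factor `r₁! ⋯ r_l! / 2!`, which is `1` for `μ = ν` and `1/2` for `μ ≠ ν`. -/
def dSecond {n : ℕ} (μ ν : Fin n) (f : Jet2 n → ℝ) (p : Jet2 n) : ℝ :=
  (if μ = ν then 1 else 1 / 2) * fderiv ℝ f p (0, 0, Pi.single s(μ, ν) 1)

/-- The equation `∑_{(ρ₁,ρ₂,ρ₃)} ∂^{μρ₁} ∂^{ρ₂ρ₃} L = 0` (cyclic sum) over the chart domain `V`. -/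
def SolvesTrivialityEquation {n : ℕ} (V : Set ((Fin n → ℝ) × ℝ)) (L : Jet2 n → ℝ) : Prop :=
  ∀ p ∈ jetDomain V, ∀ μ ρ₁ ρ₂ ρ₃ : Fin n,
    dSecond μ ρ₁ (dSecond ρ₂ ρ₃ L) p
      + dSecond μ ρ₂ (dSecond ρ₃ ρ₁ L) p
      + dSecond μ ρ₃ (dSecond ρ₁ ρ₂ L) p = 0

open Classical in
/-- The totally antisymmetric symbol `ε^{ρ₁,…,ρₙ}` with `ε^{1,…,n} = 1`. -/
def epsilon {n : ℕ} (ρ : Fin n → Fin n) : ℝ :=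
  if h : Function.Bijective ρ then ((Equiv.Perm.sign (Equiv.ofBijective ρ h) : ℤ) : ℝ) else 0

/-- The list of indices `α₁,…,α_r,τ_{r+1},…,τ_n`. -/
def joinIndices {n : ℕ} (r : Fin (n + 1)) (α : Fin (r : ℕ) → Fin n)
    (τ : Fin (n - (r : ℕ)) → Fin n) : Fin n → Fin n :=
  Fin.append α τ ∘ Fin.cast (Nat.add_sub_of_le r.is_le).symm

/-- The hyper-Jacobian `J^{ρ_{r+1},…,ρ_n}_{σ_1,…,σ_r} = ε^{ρ_1,…,ρ_n} ∏_{i=1}^r ψ_{ρ_i σ_i}`,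
summed over `ρ_1,…,ρ_r` (here `α`); the free upper indices `ρ_{r+1},…,ρ_n` are `τ`. -/
def hyperJacobian {n : ℕ} (r : Fin (n + 1)) (σ : Fin (r : ℕ) → Fin n)
    (τ : Fin (n - (r : ℕ)) → Fin n) (p : Jet2 n) : ℝ :=
  ∑ α : Fin (r : ℕ) → Fin n, epsilon (joinIndices r α τ) * ∏ i, psi2 (α i) (σ i) p

/-- Families of functions `c^{σ_1,…,σ_r}_{ρ_{r+1},…,ρ_n}`, `r = 0,…,n`, on the jet space: `c r σ τ`
with the upper indices `σ` and the lower indices `τ`. -/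
abbrev CoefficientFamily (n : ℕ) : Type :=
  ∀ r : Fin (n + 1), (Fin (r : ℕ) → Fin n) → (Fin (n - (r : ℕ)) → Fin n) → Jet2 n → ℝ

/-- The conditions on the coefficients: they are smooth functions, independent of the second
derivatives, antisymmetric in the upper and in the lower indices, and traceless. -/
structure IsAdmissible {n : ℕ} (V : Set ((Fin n → ℝ) × ℝ)) (c : CoefficientFamily n) : Prop where
  smooth : ∀ r σ τ, ContDiffOn ℝ ∞ (c r σ τ) (jetDomain V)
  independent : ∀ r σ τ, ∀ μ ν : Fin n, ∀ p ∈ jetDomain V, dSecond μ ν (c r σ τ) p = 0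
  antisymmetric : ∀ (r : Fin (n + 1)) (σ : Fin (r : ℕ) → Fin n) (τ : Fin (n - (r : ℕ)) → Fin n)
    (P : Equiv.Perm (Fin (r : ℕ))) (Q : Equiv.Perm (Fin (n - (r : ℕ)))), ∀ p ∈ jetDomain V,
      c r (σ ∘ P) (τ ∘ Q) p
        = ((Equiv.Perm.sign P : ℤ) : ℝ) * ((Equiv.Perm.sign Q : ℤ) : ℝ) * c r σ τ p
  /-- Contraction of the last upper index `i` with the last lower index `j`; both exist exactly
  for `1 ≤ r ≤ n - 1`. -/
  traceless : ∀ (r : Fin (n + 1)) (σ : Fin (r : ℕ) → Fin n) (τ : Fin (n - (r : ℕ)) → Fin n)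
    (i : Fin (r : ℕ)) (j : Fin (n - (r : ℕ))), (i : ℕ) + 1 = r → (j : ℕ) + 1 = n - r →
      ∀ p ∈ jetDomain V, ∑ ζ : Fin n, c r (Function.update σ i ζ) (Function.update τ j ζ) p = 0

/-- `L = ∑_{r=0}^n c^{σ_1,…,σ_r}_{ρ_{r+1},…,ρ_n} J^{ρ_{r+1},…,ρ_n}_{σ_1,…,σ_r}` over the chart
domain `V`, with summation over all repeated indices. -/
def IsExpansion {n : ℕ} (V : Set ((Fin n → ℝ) × ℝ)) (L : Jet2 n → ℝ)
    (c : CoefficientFamily n) : Prop :=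
  ∀ p ∈ jetDomain V, L p = ∑ r : Fin (n + 1), ∑ σ : Fin (r : ℕ) → Fin n,
    ∑ τ : Fin (n - (r : ℕ)) → Fin n, c r σ τ p * hyperJacobian r σ τ p

end

end TrivialLagrangian

/-!
The operator `∂^{μν}` is the derivative along the symmetric product `e_μ ⊙ e_ν`, so the equation
says that the second derivative `D²L(a ⊙ b, c ⊙ d)` in the fibre directions has a vanishing cyclic
sum over `b, c, d`; in particular `L` is affine along the rank one directions `a ⊙ a`.

*Existence.* The `r`-th derivatives of `L` inherit the equation in every pair of slots
(`isTrivialForm_fiberForm`). A symmetric matrix is a combination of squares `v_k ⊙ v_k` of `n`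
vectors, and a trivial form vanishes on a repeated square, so derivatives of order `n + 1` vanish
on the diagonal and `L` equals its Taylor polynomial of degree `n` in the second derivatives
(`eq_sum_iteratedFDeriv`). The coefficients are obtained by replacing `ψ_{ρσ}` by `∂^{ρσ}` in the
hyper-Jacobians and applying the result to `L` at vanishing second derivatives (`expansionCoeff`);
antisymmetry and tracelessness are then automatic. Contracting them with the hyper-Jacobians
produces two antisymmetric symbols, whose contraction is a sum over permutations `P` of the
arguments `e_{β_{P(i)}} ⊙ e_{σ_i}` (`sum_epsilon_mul_epsilon`). On a trivial form every `P`
contributes a multiple of the same Taylor term, and the multiples add up to `(r + 1)! / 2^r`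
(`IsTrivialForm.sum_sign`).

*Converse.* Admissible coefficients are constant along the fibres, and in the second derivative of
a hyper-Jacobian the antisymmetric symbol is contracted with a form made symmetric by the cyclic
sum (`solvesTrivialityEquation_hyperJacobian`).

*Uniqueness.* By homogeneity each degree `r` may be treated separately. Dualizing the lower
indices turns the difference of two families into an array `b(σ; α)`, antisymmetric in both lists,
for which tracelessness is the Bianchi identity, by Cramer's rule (`sum_mul_epsilon_bianchi`). If
the polynomial `∑ b(σ; α) ∏ ψ_{α_i σ_i}` vanishes, then `b(v_1, …, v_r; v_1, …, v_r) = 0` for all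
vectors (`diagonal_eq_zero_of_sum_eq_zero`), which together with the Bianchi identity forces
`b = 0` (`eq_zero_of_bianchi`).
-/

namespace TrivialLagrangian

noncomputable section

variable {n : ℕ}

/-! ### The antisymmetric symbol -/

theorem epsilon_eq_zero {ρ : Fin n → Fin n} (h : ¬ Function.Injective ρ) : epsilon ρ = 0 :=
  dif_neg fun hb => h hb.1

theorem epsilon_perm (π : Equiv.Perm (Fin n)) : epsilon π = ((Equiv.Perm.sign π : ℤ) : ℝ) := by
  rw [epsilon, dif_pos π.bijective]
  congr 3
  ext; rfl

theorem epsilon_ne_zero_iff {ρ : Fin n → Fin n} : epsilon ρ ≠ 0 ↔ Function.Injective ρ := by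
  refine ⟨fun h => by_contra fun h' => h (epsilon_eq_zero h'), fun h => ?_⟩
  obtain ⟨π, rfl⟩ : ∃ π : Equiv.Perm (Fin n), ⇑π = ρ :=
    ⟨Equiv.ofBijective ρ (Finite.injective_iff_bijective.1 h), rfl⟩
  rw [epsilon_perm]
  exact_mod_cast (Equiv.Perm.sign π).ne_zero

/-- The antisymmetric symbol is the determinant of the matrix with rows `e_{ρ_1}, …, e_{ρ_n}`. -/
theorem epsilon_eq_det (ρ : Fin n → Fin n) :
    epsilon ρ = ((1 : Matrix (Fin n) (Fin n) ℝ).submatrix ρ id).det := by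
  by_cases h : Function.Injective ρ
  · obtain ⟨π, rfl⟩ : ∃ π : Equiv.Perm (Fin n), ⇑π = ρ :=
      ⟨Equiv.ofBijective ρ (Finite.injective_iff_bijective.1 h), rfl⟩
    rw [epsilon_perm, Matrix.det_permute, Matrix.det_one, mul_one]
  · rw [epsilon_eq_zero h]
    simp only [Function.Injective, not_forall] at h
    obtain ⟨i, j, hij, hne⟩ := h
    refine (Matrix.det_zero_of_row_eq hne (funext fun k => ?_)).symm
    rw [Matrix.submatrix_apply, Matrix.submatrix_apply, hij]

theorem epsilon_comp_perm (ρ : Fin n → Fin n) (π : Equiv.Perm (Fin n)) :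
    epsilon (ρ ∘ π) = ((Equiv.Perm.sign π : ℤ) : ℝ) * epsilon ρ := by
  rw [epsilon_eq_det, epsilon_eq_det, ← Matrix.det_permute]
  rfl

theorem epsilon_perm_comp (ρ : Fin n → Fin n) (π : Equiv.Perm (Fin n)) :
    epsilon (π ∘ ρ) = ((Equiv.Perm.sign π : ℤ) : ℝ) * epsilon ρ := by
  by_cases h : Function.Injective ρ
  · obtain ⟨κ, rfl⟩ : ∃ κ : Equiv.Perm (Fin n), ⇑κ = ρ :=
      ⟨Equiv.ofBijective ρ (Finite.injective_iff_bijective.1 h), rfl⟩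
    rw [← Equiv.Perm.coe_mul, epsilon_perm, epsilon_perm, Equiv.Perm.sign_mul]
    push_cast
    rfl
  · rw [epsilon_eq_zero h, epsilon_eq_zero, mul_zero]
    exact fun h' => h h'.of_comp

theorem sign_mul_self {ι : Type*} [Fintype ι] [DecidableEq ι] (π : Equiv.Perm ι) :
    ((Equiv.Perm.sign π : ℤ) : ℝ) * ((Equiv.Perm.sign π : ℤ) : ℝ) = 1 := by
  rcases Int.units_eq_one_or (Equiv.Perm.sign π) with h | h <;> simp [h]

/-- Cramer's rule for the unit vectors `e_{ρ_1}, …, e_{ρ_n}`: antisymmetrization over `n + 1`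
indices vanishes in dimension `n`. -/
theorem epsilon_exchange (ρ : Fin n → Fin n) (s ζ : Fin n) :
    (∑ j, if ρ j = ζ then epsilon (Function.update ρ j s) else 0)
      = if s = ζ then epsilon ρ else 0 := by
  have h := congrFun (Matrix.mulVec_cramer
    ((1 : Matrix (Fin n) (Fin n) ℝ).submatrix ρ id).transpose (Pi.single s 1)) ζ
  rw [Matrix.det_transpose, ← epsilon_eq_det] at h
  simp only [Matrix.mulVec, dotProduct, Matrix.transpose_apply, Matrix.submatrix_apply, id,
    Matrix.one_apply, Pi.smul_apply, smul_eq_mul, Pi.single_apply, ite_mul, one_mul, zero_mul,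
    mul_ite, mul_one, mul_zero] at h
  rw [show (if s = ζ then epsilon ρ else 0) = if ζ = s then epsilon ρ else 0 by
    simp only [eq_comm], ← h]
  refine Finset.sum_congr rfl fun j _ => ?_
  rw [Matrix.cramer_apply, Matrix.updateCol_transpose, Matrix.det_transpose, epsilon_eq_det]
  congr 2
  ext a b
  by_cases hj : a = j
  · subst hj
    simp [Matrix.one_apply, Pi.single_apply, eq_comm]
  · rw [Matrix.updateRow_ne hj, Matrix.submatrix_apply, Matrix.submatrix_apply,
      Function.update_of_ne hj]

/-! ### Joined index lists -/

/-- The positions `1, …, n` split into the first `r` and the last `n - r`. -/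
def splitEquiv (r : Fin (n + 1)) : Fin (r : ℕ) ⊕ Fin (n - (r : ℕ)) ≃ Fin n :=
  finSumFinEquiv.trans (finCongr (Nat.add_sub_of_le r.is_le))

theorem joinIndices_eq (r : Fin (n + 1)) (α : Fin (r : ℕ) → Fin n)
    (τ : Fin (n - (r : ℕ)) → Fin n) :
    joinIndices r α τ = Sum.elim α τ ∘ (splitEquiv r).symm := by
  rw [Equiv.eq_comp_symm]
  ext i
  rcases i with i | i <;> simp [joinIndices, splitEquiv]

theorem joinIndices_splitEquiv_inl (r : Fin (n + 1)) (α : Fin (r : ℕ) → Fin n)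
    (τ : Fin (n - (r : ℕ)) → Fin n) (i : Fin (r : ℕ)) :
    joinIndices r α τ (splitEquiv r (Sum.inl i)) = α i := by
  simp [joinIndices_eq]

theorem joinIndices_splitEquiv_inr (r : Fin (n + 1)) (α : Fin (r : ℕ) → Fin n)
    (τ : Fin (n - (r : ℕ)) → Fin n) (i : Fin (n - (r : ℕ))) :
    joinIndices r α τ (splitEquiv r (Sum.inr i)) = τ i := by
  simp [joinIndices_eq]

theorem joinIndices_injective_iff {r : Fin (n + 1)} {α : Fin (r : ℕ) → Fin n}
    {τ : Fin (n - (r : ℕ)) → Fin n} :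
    Function.Injective (joinIndices r α τ) ↔
      Function.Injective α ∧ Function.Injective τ ∧ ∀ i j, α i ≠ τ j := by
  rw [joinIndices_eq, Equiv.injective_comp]
  refine ⟨fun h => ⟨h.comp Sum.inl_injective, h.comp Sum.inr_injective, fun i j hij => ?_⟩,
    fun h => h.1.sumElim h.2.1 h.2.2⟩
  exact absurd (h (a₁ := Sum.inl i) (a₂ := Sum.inr j) hij) Sum.inl_ne_inr

theorem joinIndices_update_left (r : Fin (n + 1)) (α : Fin (r : ℕ) → Fin n)
    (τ : Fin (n - (r : ℕ)) → Fin n) (i : Fin (r : ℕ)) (s : Fin n) :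
    joinIndices r (Function.update α i s) τ
      = Function.update (joinIndices r α τ) (splitEquiv r (Sum.inl i)) s := by
  rw [joinIndices_eq, joinIndices_eq, ← Sum.update_elim_inl, Function.update_comp_equiv]
  simp

theorem joinIndices_update_right (r : Fin (n + 1)) (α : Fin (r : ℕ) → Fin n)
    (τ : Fin (n - (r : ℕ)) → Fin n) (i : Fin (n - (r : ℕ))) (s : Fin n) :
    joinIndices r α (Function.update τ i s)
      = Function.update (joinIndices r α τ) (splitEquiv r (Sum.inr i)) s := by
  rw [joinIndices_eq, joinIndices_eq, ← Sum.update_elim_inr, Function.update_comp_equiv]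
  simp

theorem epsilon_joinIndices_comp (r : Fin (n + 1)) (α : Fin (r : ℕ) → Fin n)
    (τ : Fin (n - (r : ℕ)) → Fin n) (P : Equiv.Perm (Fin (r : ℕ)))
    (Q : Equiv.Perm (Fin (n - (r : ℕ)))) :
    epsilon (joinIndices r (α ∘ P) (τ ∘ Q))
      = ((Equiv.Perm.sign P : ℤ) : ℝ) * ((Equiv.Perm.sign Q : ℤ) : ℝ)
        * epsilon (joinIndices r α τ) := by
  have h : joinIndices r (α ∘ P) (τ ∘ Q)
      = joinIndices r α τ ∘ (splitEquiv r).permCongr (Equiv.Perm.sumCongr P Q) := by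
    rw [joinIndices_eq, joinIndices_eq]
    ext i
    obtain ⟨i, rfl⟩ := (splitEquiv r).surjective i
    rcases i with i | i <;> simp
  rw [h, epsilon_comp_perm, Equiv.Perm.sign_permCongr, Equiv.Perm.sign_sumCongr]
  push_cast
  ring

theorem epsilon_joinIndices_comp_left (r : Fin (n + 1)) (α : Fin (r : ℕ) → Fin n)
    (τ : Fin (n - (r : ℕ)) → Fin n) (P : Equiv.Perm (Fin (r : ℕ))) :
    epsilon (joinIndices r (α ∘ P) τ)
      = ((Equiv.Perm.sign P : ℤ) : ℝ) * epsilon (joinIndices r α τ) := by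
  simpa using epsilon_joinIndices_comp r α τ P 1

/-- If two lists `α`, `β` are both completed to permutations by the same list `τ`, then they are
rearrangements of each other. -/
theorem exists_perm_of_joinIndices {r : Fin (n + 1)} {α β : Fin (r : ℕ) → Fin n}
    {τ : Fin (n - (r : ℕ)) → Fin n} (hα : Function.Injective (joinIndices r α τ))
    (hβ : Function.Injective (joinIndices r β τ)) :
    ∃ P : Equiv.Perm (Fin (r : ℕ)), α = β ∘ P := by
  have key : ∀ i, ∃ j, β j = α i := by
    intro i
    obtain ⟨k, hk⟩ := (Finite.injective_iff_surjective.1 hβ) (α i)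
    obtain ⟨k, rfl⟩ := (splitEquiv r).surjective k
    rcases k with k | k
    · exact ⟨k, by rwa [joinIndices_splitEquiv_inl] at hk⟩
    · rw [joinIndices_splitEquiv_inr] at hk
      exact absurd hk.symm ((joinIndices_injective_iff.1 hα).2.2 i k)
  choose P hP using key
  have hP' : Function.Injective P := fun i j hij =>
    (joinIndices_injective_iff.1 hα).1 (by rw [← hP, ← hP, hij])
  exact ⟨Equiv.ofBijective P (Finite.injective_iff_bijective.1 hP'), by ext i; simp [hP]⟩

theorem exists_perm_of_joinIndices_right {r : Fin (n + 1)} {α : Fin (r : ℕ) → Fin n}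
    {τ τ' : Fin (n - (r : ℕ)) → Fin n} (hτ : Function.Injective (joinIndices r α τ))
    (hτ' : Function.Injective (joinIndices r α τ')) :
    ∃ Q : Equiv.Perm (Fin (n - (r : ℕ))), τ = τ' ∘ Q := by
  have key : ∀ i, ∃ j, τ' j = τ i := by
    intro i
    obtain ⟨k, hk⟩ := (Finite.injective_iff_surjective.1 hτ') (τ i)
    obtain ⟨k, rfl⟩ := (splitEquiv r).surjective k
    rcases k with k | k
    · rw [joinIndices_splitEquiv_inl] at hk
      exact absurd hk ((joinIndices_injective_iff.1 hτ).2.2 k i)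
    · exact ⟨k, by rwa [joinIndices_splitEquiv_inr] at hk⟩
  choose P hP using key
  have hP' : Function.Injective P := fun i j hij =>
    (joinIndices_injective_iff.1 hτ).2.1 (by rw [← hP, ← hP, hij])
  exact ⟨Equiv.ofBijective P (Finite.injective_iff_bijective.1 hP'), by ext i; simp [hP]⟩

/-- Any list of distinct indices is the image of any other one under a permutation. -/
theorem exists_perm_comp_eq {ι : Type*} {f g : ι → Fin n} (hf : Function.Injective f)
    (hg : Function.Injective g) : ∃ π : Equiv.Perm (Fin n), g = π ∘ f := by
  classical
  let e := (Equiv.ofInjective f hf).symm.trans (Equiv.ofInjective g hg)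
  refine ⟨e.extendSubtype, funext fun i => ?_⟩
  rw [Function.comp_apply, e.extendSubtype_apply_of_mem (f i) ⟨i, rfl⟩]
  have h : (Equiv.ofInjective f hf).symm ⟨f i, ⟨i, rfl⟩⟩ = i := by
    rw [Equiv.symm_apply_eq]; rfl
  simp [e, h]

theorem joinIndices_splitEquiv (r : Fin (n + 1)) :
    joinIndices r (splitEquiv r ∘ Sum.inl) (splitEquiv r ∘ Sum.inr) = id := by
  rw [joinIndices_eq, Equiv.comp_symm_eq]
  ext i
  rcases i with i | i <;> simp

theorem joinIndices_comp (r : Fin (n + 1)) (π : Fin n → Fin n) (α : Fin (r : ℕ) → Fin n)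
    (τ : Fin (n - (r : ℕ)) → Fin n) :
    joinIndices r (π ∘ α) (π ∘ τ) = π ∘ joinIndices r α τ := by
  rw [joinIndices_eq, joinIndices_eq, ← Sum.comp_elim]
  rfl

/-! ### Contraction of two antisymmetric symbols -/

/-- The sum `∑ (ε^{1,…,r,τ_{r+1},…,τ_n})²`, which is `(n - r)!`; only its positivity matters. -/
def epsilonNorm (r : Fin (n + 1)) : ℝ :=
  ∑ τ : Fin (n - (r : ℕ)) → Fin n, epsilon (joinIndices r (splitEquiv r ∘ Sum.inl) τ) ^ 2

theorem epsilonNorm_pos (r : Fin (n + 1)) : 0 < epsilonNorm r := by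
  refine Finset.sum_pos' (fun τ _ => sq_nonneg _)
    ⟨splitEquiv r ∘ Sum.inr, Finset.mem_univ _, ?_⟩
  rw [joinIndices_splitEquiv]
  exact (sq_nonneg _).lt_of_ne' (pow_ne_zero 2 (epsilon_ne_zero_iff.2 Function.injective_id))

theorem sum_epsilon_sq (r : Fin (n + 1)) {α : Fin (r : ℕ) → Fin n} (hα : Function.Injective α) :
    ∑ τ : Fin (n - (r : ℕ)) → Fin n, epsilon (joinIndices r α τ) ^ 2 = epsilonNorm r := by
  obtain ⟨π, rfl⟩ := exists_perm_comp_eq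
    ((splitEquiv r).injective.comp Sum.inl_injective) hα
  rw [epsilonNorm, ← Equiv.sum_comp (Equiv.arrowCongr (Equiv.refl (Fin (n - (r : ℕ)))) π)]
  refine Finset.sum_congr rfl fun τ _ => ?_
  have h : (Equiv.arrowCongr (Equiv.refl (Fin (n - (r : ℕ)))) π) τ = π ∘ τ := rfl
  rw [h, joinIndices_comp, epsilon_perm_comp, mul_pow, sq, sign_mul_self, one_mul]

theorem comp_swap_eq_self {ι κ : Type*} [DecidableEq ι] {β : ι → κ} {i j : ι} (h : β i = β j) :
    β ∘ Equiv.swap i j = β := by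
  funext k
  rw [Function.comp_apply, Equiv.swap_apply_def]
  split_ifs with h1 h2
  · rw [h1, h]
  · rw [h2, h]
  · rfl

theorem sum_sign_comp_perm_eq_zero {ι κ : Type*} [Fintype ι] [DecidableEq ι] {β : ι → κ}
    (hβ : ¬ Function.Injective β) (X : (ι → κ) → ℝ) :
    ∑ P : Equiv.Perm ι, ((Equiv.Perm.sign P : ℤ) : ℝ) * X (β ∘ P) = 0 := by
  simp only [Function.Injective, not_forall] at hβ
  obtain ⟨i, j, hij, hne⟩ := hβ
  have h := comp_swap_eq_self hij
  have key := Equiv.sum_comp (Equiv.mulLeft (Equiv.swap i j))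
    fun P : Equiv.Perm ι => ((Equiv.Perm.sign P : ℤ) : ℝ) * X (β ∘ P)
  simp only [Equiv.coe_mulLeft, Equiv.Perm.sign_mul, Equiv.Perm.sign_swap hne,
    Equiv.Perm.coe_mul, ← Function.comp_assoc, h] at key
  simp only [neg_mul, one_mul, Units.val_neg, Int.cast_neg, Finset.sum_neg_distrib] at key
  linarith

/-- Contracting two antisymmetric symbols over their last `n - r` indices gives a multiple of the
generalized Kronecker delta. -/
theorem sum_epsilon_mul_epsilon (r : Fin (n + 1)) (β : Fin (r : ℕ) → Fin n)
    (X : (Fin (r : ℕ) → Fin n) → ℝ) :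
    ∑ α : Fin (r : ℕ) → Fin n, (∑ τ : Fin (n - (r : ℕ)) → Fin n,
        epsilon (joinIndices r α τ) * epsilon (joinIndices r β τ)) * X α
      = epsilonNorm r * ∑ P : Equiv.Perm (Fin (r : ℕ)),
          ((Equiv.Perm.sign P : ℤ) : ℝ) * X (β ∘ P) := by
  by_cases hβ : Function.Injective β
  · rw [Finset.mul_sum]
    symm
    refine Fintype.sum_of_injective (fun P : Equiv.Perm (Fin (r : ℕ)) => β ∘ P) ?_ _ _ ?_ ?_
    · intro P Q hPQ
      ext i
      exact congrArg Fin.val (hβ (congrFun hPQ i))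
    · intro α hα
      rw [Finset.sum_eq_zero, zero_mul]
      intro τ _
      by_contra hne
      have h := mul_ne_zero_iff.1 hne
      obtain ⟨P, rfl⟩ := exists_perm_of_joinIndices (epsilon_ne_zero_iff.1 h.1)
        (epsilon_ne_zero_iff.1 h.2)
      exact hα ⟨P, rfl⟩
    · intro P
      simp only [epsilon_joinIndices_comp_left, mul_assoc, ← sq, ← Finset.mul_sum,
        sum_epsilon_sq r hβ]
      ring
  · rw [sum_sign_comp_perm_eq_zero hβ, mul_zero]
    refine Finset.sum_eq_zero fun α _ => ?_
    rw [Finset.sum_eq_zero, zero_mul]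
    intro τ _
    rw [epsilon_eq_zero (ρ := joinIndices r β τ), mul_zero]
    exact fun h => hβ (joinIndices_injective_iff.1 h).1

/-! ### Symmetric products of vectors -/

/-- The symmetric product `a ⊙ b` of two vectors, with components `(a_i b_j + a_j b_i) / 2`. -/
def symMul (a b : Fin n → ℝ) : Sym2 (Fin n) → ℝ :=
  Sym2.lift ⟨fun i j => (a i * b j + a j * b i) / 2, fun i j => by ring⟩

/-- The unit vector `e_μ`. -/
abbrev unitVec (μ : Fin n) : Fin n → ℝ := Pi.single μ 1

theorem symMul_mk (a b : Fin n → ℝ) (i j : Fin n) :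
    symMul a b s(i, j) = (a i * b j + a j * b i) / 2 := rfl

theorem symMul_comm (a b : Fin n → ℝ) : symMul a b = symMul b a := by
  ext s
  induction s with
  | _ i j => rw [symMul_mk, symMul_mk]; ring

theorem symMul_eq_sum (a b : Fin n → ℝ) :
    symMul a b = ∑ p : Fin n × Fin n, (a p.1 * b p.2) • symMul (unitVec p.1) (unitVec p.2) := by
  ext s
  induction s with
  | _ i j =>
    simp only [Finset.sum_apply, Pi.smul_apply, symMul_mk, Fintype.sum_prod_type, smul_eq_mul,
      Pi.single_apply, mul_ite, mul_one, mul_zero, mul_add, add_div, Finset.sum_add_distrib]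
    simp only [ite_div, zero_div, mul_zero, Finset.sum_ite_eq, Finset.mem_univ, if_true,
      apply_ite]
    ring

theorem eq_sum_symMul_unitVec (h : Sym2 (Fin n) → ℝ) :
    h = ∑ p : Fin n × Fin n, h s(p.1, p.2) • symMul (unitVec p.1) (unitVec p.2) := by
  ext s
  induction s with
  | _ i j =>
    simp only [Finset.sum_apply, Pi.smul_apply, symMul_mk, Fintype.sum_prod_type, smul_eq_mul,
      Pi.single_apply, mul_ite, mul_one, mul_zero, mul_add, add_div, Finset.sum_add_distrib]
    simp only [ite_div, zero_div, mul_zero, Finset.sum_ite_eq, Finset.mem_univ, if_true,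
      apply_ite, Sym2.eq_swap (a := j)]
    ring

theorem symMul_unitVec (μ ν : Fin n) :
    symMul (unitVec μ) (unitVec ν)
      = (if μ = ν then (1 : ℝ) else 1 / 2) • Pi.single s(μ, ν) (1 : ℝ) := by
  ext s
  induction s with
  | _ i j =>
    simp only [symMul_mk, Pi.smul_apply, Pi.single_apply, smul_eq_mul, Sym2.eq_iff]
    split_ifs <;> grind

/-- Every symmetric matrix is a linear combination of `n` squares of vectors. -/
theorem exists_eq_sum_symMul_self (h : Sym2 (Fin n) → ℝ) :
    ∃ (l : Fin n → ℝ) (v : Fin n → Fin n → ℝ), h = ∑ k, l k • symMul (v k) (v k) := by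
  have hA : (Matrix.of fun i j => h s(i, j)).IsHermitian := by
    ext i j
    simp [Sym2.eq_swap (a := j)]
  refine ⟨hA.eigenvalues, fun k i => hA.eigenvectorUnitary.1 i k, ?_⟩
  ext s
  induction s with
  | _ i j =>
    have := congrFun (congrFun hA.spectral_theorem i) j
    rw [Unitary.conjStarAlgAut_apply, Matrix.mul_apply] at this
    simp only [Matrix.of_apply, Matrix.mul_diagonal, Matrix.star_apply] at this
    rw [this, Finset.sum_apply]
    refine Finset.sum_congr rfl fun k _ => ?_
    simp [symMul_mk]
    ring

/-! ### Forms that vanish on repeated squares -/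

/-- The triviality equation for a form `D` of degree `r` on symmetric matrices: for any two slots
`D(…, a ⊙ a, …, b ⊙ c, …) + 2 D(…, a ⊙ b, …, a ⊙ c, …) = 0`. -/
def IsTrivialForm {r : ℕ} (D : (Fin r → Sym2 (Fin n) → ℝ) → ℝ) : Prop :=
  ∀ i j : Fin r, i ≠ j → ∀ (m : Fin r → Sym2 (Fin n) → ℝ) (a b c : Fin n → ℝ),
    D (Function.update (Function.update m i (symMul a a)) j (symMul b c))
      + 2 * D (Function.update (Function.update m i (symMul a b)) j (symMul a c)) = 0

theorem IsTrivialForm.cons {r : ℕ} {D : (Fin (r + 1) → Sym2 (Fin n) → ℝ) → ℝ}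
    (hD : IsTrivialForm D) (s : Sym2 (Fin n) → ℝ) :
    IsTrivialForm fun m : Fin r → Sym2 (Fin n) → ℝ =>
      D (Fin.cons (α := fun _ => Sym2 (Fin n) → ℝ) s m) := by
  intro i j hij m a b c
  simp only [Fin.cons_update]
  exact hD i.succ j.succ (by simpa using hij) _ a b c

/-- Exchanging `v_0` with `v_{j+1}` in the first factors of the symmetric products multiplies a
trivial form by `-1/2`. -/
theorem IsTrivialForm.swap_zero {r : ℕ} {D : (Fin (r + 1) → Sym2 (Fin n) → ℝ) → ℝ}
    (hD : IsTrivialForm D) (v : Fin (r + 1) → Fin n → ℝ) (e : Equiv.Perm (Fin r)) (j : Fin r) :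
    D (fun i => symMul (v (Equiv.Perm.decomposeFin.symm (j.succ, e) i)) (v i))
      = -(1 / 2) * D (Fin.cons (α := fun _ => Sym2 (Fin n) → ℝ) (symMul (v 0) (v 0))
          fun i => symMul (v (e i).succ) (v i.succ)) := by
  obtain ⟨k, rfl⟩ := e.surjective j
  have h := hD 0 k.succ (Fin.succ_ne_zero k).symm
    (Fin.cons (α := fun _ => Sym2 (Fin n) → ℝ) 0 fun i => symMul (v (e i).succ) (v i.succ))
    (v 0) (v (e k).succ) (v k.succ)
  have h1 : Function.update (Function.update
      (Fin.cons (α := fun _ => Sym2 (Fin n) → ℝ) 0 fun i => symMul (v (e i).succ) (v i.succ)) 0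
        (symMul (v 0) (v 0))) k.succ (symMul (v (e k).succ) (v k.succ))
      = Fin.cons (α := fun _ => Sym2 (Fin n) → ℝ) (symMul (v 0) (v 0))
          fun i => symMul (v (e i).succ) (v i.succ) := by
    rw [Fin.update_cons_zero, ← Fin.cons_update, Function.update_eq_self]
  have h2 : Function.update (Function.update
      (Fin.cons (α := fun _ => Sym2 (Fin n) → ℝ) 0 fun i => symMul (v (e i).succ) (v i.succ)) 0
        (symMul (v 0) (v (e k).succ))) k.succ (symMul (v 0) (v k.succ))
      = fun i => symMul (v (Equiv.Perm.decomposeFin.symm ((e k).succ, e) i)) (v i) := by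
    rw [Fin.update_cons_zero, ← Fin.cons_update]
    funext i
    refine Fin.cases ?_ (fun i => ?_) i
    · rw [Fin.cons_zero, Equiv.Perm.decomposeFin_symm_apply_zero, symMul_comm]
    · rw [Fin.cons_succ, Equiv.Perm.decomposeFin_symm_apply_succ]
      by_cases hik : i = k
      · subst hik
        rw [Function.update_self, Equiv.swap_apply_right]
      · rw [Function.update_of_ne hik, Equiv.swap_apply_of_ne_of_ne (Fin.succ_ne_zero _)]
        intro h
        exact hik (e.injective (Fin.succ_injective _ h))
  rw [h1, h2] at h
  linarith

/-- On a trivial form, antisymmetrizing `v_{P(1)} ⊙ v_1, …, v_{P(r)} ⊙ v_r` over `P` gives back the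
value on squares: a permutation with `k` cycles contributes `(-1)^{r-k} (-1/2)^{r-k}`. -/
theorem IsTrivialForm.sum_sign {r : ℕ} {D : (Fin r → Sym2 (Fin n) → ℝ) → ℝ}
    (hD : IsTrivialForm D) (v : Fin r → Fin n → ℝ) :
    ∑ P : Equiv.Perm (Fin r), ((Equiv.Perm.sign P : ℤ) : ℝ) * D (fun i => symMul (v (P i)) (v i))
      = ((r + 1).factorial : ℝ) / 2 ^ r * D fun i => symMul (v i) (v i) := by
  induction r with
  | zero =>
    simp only [Finset.univ_unique, Finset.sum_singleton, Nat.zero_add, Nat.factorial_one,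
      Nat.cast_one, pow_zero, div_one, one_mul]
    have : (default : Equiv.Perm (Fin 0)) = 1 := Subsingleton.elim _ _
    simp [this]
  | succ r ih =>
    have hcons : ∀ w : Fin r → Fin r, (fun i => symMul
        (v (Fin.cons (α := fun _ => Fin (r + 1)) 0 (fun i => (w i).succ) i)) (v i))
        = Fin.cons (α := fun _ => Sym2 (Fin n) → ℝ) (symMul (v 0) (v 0))
          fun i => symMul (v (w i).succ) (v i.succ) := by
      intro w
      funext i
      refine Fin.cases ?_ (fun i => ?_) i <;> simp
    have hzero : ∀ e : Equiv.Perm (Fin r),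
        (fun i => symMul (v (Equiv.Perm.decomposeFin.symm (0, e) i)) (v i))
        = Fin.cons (α := fun _ => Sym2 (Fin n) → ℝ) (symMul (v 0) (v 0))
          fun i => symMul (v (e i).succ) (v i.succ) := by
      intro e
      rw [← hcons]
      funext i
      refine Fin.cases ?_ (fun i => ?_) i
      · simp
      · rw [Equiv.Perm.decomposeFin_symm_apply_succ, Equiv.swap_self]
        simp
    have hid := hcons id
    rw [show (Fin.cons (α := fun _ => Fin (r + 1)) 0 (fun i => (id i : Fin r).succ)) = id by
      funext i; refine Fin.cases ?_ (fun i => ?_) i <;> simp] at hid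
    have ih' := ih (hD.cons (symMul (v 0) (v 0))) fun i => v i.succ
    rw [← Equiv.sum_comp Equiv.Perm.decomposeFin.symm, Fintype.sum_prod_type, Fin.sum_univ_succ]
    simp only [Equiv.Perm.decomposeFin.symm_sign, hzero, hD.swap_zero, Fin.succ_ne_zero, if_false,
      if_true, one_mul, neg_mul, Units.val_neg, Int.cast_neg, mul_neg, neg_neg]
    simp only [mul_left_comm _ (1 / 2 : ℝ), ← Finset.mul_sum]
    rw [ih']
    simp only [id] at hid
    rw [hid, Finset.sum_const, Finset.card_univ, Fintype.card_fin, nsmul_eq_mul,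
      Nat.factorial_succ (r + 1)]
    push_cast
    ring

/-- With equal vectors the triviality equation reads `3 D(…, a ⊙ a, …, a ⊙ a, …) = 0`. -/
theorem IsTrivialForm.apply_eq_zero {r : ℕ} {D : (Fin r → Sym2 (Fin n) → ℝ) → ℝ}
    (hD : IsTrivialForm D) {v : Fin r → Fin n → ℝ} {i j : Fin r} (hij : i ≠ j) (hv : v i = v j) :
    D (fun i => symMul (v i) (v i)) = 0 := by
  have h := hD i j hij (fun i => symMul (v i) (v i)) (v i) (v i) (v i)
  have h1 : Function.update (Function.update (fun i => symMul (v i) (v i)) i (symMul (v i) (v i))) j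
      (symMul (v i) (v i)) = fun i => symMul (v i) (v i) := by
    rw [Function.update_eq_self, hv, Function.update_eq_self]
  rw [h1] at h
  linarith

theorem map_symMul_eq_sum {r : ℕ}
    (D : MultilinearMap ℝ (fun _ : Fin r => Sym2 (Fin n) → ℝ) ℝ) (w v : Fin r → Fin n → ℝ) :
    D (fun i => symMul (w i) (v i)) = ∑ β : Fin r → Fin n, ∑ σ : Fin r → Fin n,
      (∏ i, w i (β i)) * (∏ i, v i (σ i)) * D fun i => symMul (unitVec (β i)) (unitVec (σ i)) := by
  simp only [symMul_eq_sum (w _) (v _)]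
  rw [D.map_sum, ← Fintype.sum_prod_type', ← Equiv.sum_comp (Equiv.arrowProdEquivProdArrow _ _ _)]
  refine Finset.sum_congr rfl fun p _ => ?_
  rw [D.map_smul_univ, Finset.prod_mul_distrib, smul_eq_mul]
  rfl

theorem map_sum_smul_symMul {r : ℕ}
    (D : MultilinearMap ℝ (fun _ : Fin r => Sym2 (Fin n) → ℝ) ℝ) (l : Fin n → ℝ)
    (v : Fin n → Fin n → ℝ) :
    D (fun _ => ∑ k, l k • symMul (v k) (v k))
      = ∑ κ : Fin r → Fin n, (∏ i, l (κ i)) * D fun i => symMul (v (κ i)) (v (κ i)) := by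
  rw [D.map_sum]
  simp only [D.map_smul_univ, smul_eq_mul]

/-- A trivial form of degree larger than the dimension vanishes on the diagonal, since the squares
of `n` vectors span a given symmetric matrix. -/
theorem IsTrivialForm.diagonal_eq_zero {r : ℕ}
    {D : MultilinearMap ℝ (fun _ : Fin r => Sym2 (Fin n) → ℝ) ℝ} (hD : IsTrivialForm D)
    (hr : n < r) (h : Sym2 (Fin n) → ℝ) : D (fun _ => h) = 0 := by
  obtain ⟨l, v, rfl⟩ := exists_eq_sum_symMul_self h
  rw [map_sum_smul_symMul]
  refine Finset.sum_eq_zero fun κ _ => ?_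
  obtain ⟨i, j, hij, hκ⟩ := Fintype.exists_ne_map_eq_of_card_lt κ (by simpa using hr)
  rw [hD.apply_eq_zero hij (congrArg v hκ), mul_zero]

/-- Antisymmetrizing the coefficients of a trivial form in the first indices of the symmetric
products does not change its values on the diagonal, up to a factor. -/
theorem IsTrivialForm.sum_sign_diagonal {r : ℕ}
    {D : MultilinearMap ℝ (fun _ : Fin r => Sym2 (Fin n) → ℝ) ℝ} (hD : IsTrivialForm D)
    (h : Sym2 (Fin n) → ℝ) :
    ∑ β : Fin r → Fin n, ∑ σ : Fin r → Fin n, (∏ i, h s(β i, σ i)) *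
      ∑ P : Equiv.Perm (Fin r), ((Equiv.Perm.sign P : ℤ) : ℝ) *
        D (fun i => symMul (unitVec (β (P i))) (unitVec (σ i)))
      = ((r + 1).factorial : ℝ) / 2 ^ r * D fun _ => h := by
  obtain ⟨l, v, hh⟩ := exists_eq_sum_symMul_self h
  have hentry : ∀ i j, h s(i, j) = ∑ k, l k * (v k i * v k j) := by
    intro i j
    rw [hh]
    simp only [Finset.sum_apply, Pi.smul_apply, symMul_mk, smul_eq_mul]
    exact Finset.sum_congr rfl fun k _ => by ring
  have hprod : ∀ β σ : Fin r → Fin n, ∏ i, h s(β i, σ i) = ∑ κ : Fin r → Fin n,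
      (∏ i, l (κ i)) * ((∏ i, v (κ i) (β i)) * ∏ i, v (κ i) (σ i)) := by
    intro β σ
    simp only [hentry, Finset.prod_univ_sum, Fintype.piFinset_univ, Finset.prod_mul_distrib]
  have hP : ∀ (κ : Fin r → Fin n) (P : Equiv.Perm (Fin r)),
      ∑ β : Fin r → Fin n, ∑ σ : Fin r → Fin n, (∏ i, v (κ i) (β i)) * (∏ i, v (κ i) (σ i)) *
        D (fun i => symMul (unitVec (β (P i))) (unitVec (σ i)))
      = D fun i => symMul (v (κ (P i))) (v (κ i)) := by
    intro κ P
    rw [map_symMul_eq_sum]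
    conv_rhs => rw [← Equiv.sum_comp (Equiv.arrowCongr P.symm (Equiv.refl (Fin n)))]
    refine Finset.sum_congr rfl fun β _ => Finset.sum_congr rfl fun σ _ => ?_
    have hβ : ∀ i, (Equiv.arrowCongr P.symm (Equiv.refl (Fin n))) β i = β (P i) := fun i => rfl
    simp only [hβ]
    rw [Equiv.prod_comp P fun i => v (κ i) (β i)]
  have hcomm : ∀ {A B C : Type} [Fintype A] [Fintype B] [Fintype C] (F : A → B → C → ℝ),
      ∑ a, ∑ b, ∑ c, F a b c = ∑ c, ∑ a, ∑ b, F a b c := fun F =>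
    (Finset.sum_congr rfl fun a _ => Finset.sum_comm).trans Finset.sum_comm
  calc _ = ∑ β : Fin r → Fin n, ∑ σ : Fin r → Fin n, ∑ κ : Fin r → Fin n,
        ∑ P : Equiv.Perm (Fin r), (∏ i, l (κ i)) * (((Equiv.Perm.sign P : ℤ) : ℝ) *
          ((∏ i, v (κ i) (β i)) * (∏ i, v (κ i) (σ i)) *
            D (fun i => symMul (unitVec (β (P i))) (unitVec (σ i))))) := by
        refine Finset.sum_congr rfl fun β _ => Finset.sum_congr rfl fun σ _ => ?_
        rw [hprod, Finset.sum_mul_sum]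
        refine Finset.sum_congr rfl fun κ _ => Finset.sum_congr rfl fun P _ => by ring
    _ = ∑ κ : Fin r → Fin n, (∏ i, l (κ i)) * ∑ P : Equiv.Perm (Fin r),
          ((Equiv.Perm.sign P : ℤ) : ℝ) * D (fun i => symMul (v (κ (P i))) (v (κ i))) := by
        rw [hcomm]
        refine Finset.sum_congr rfl fun κ _ => ?_
        rw [hcomm, Finset.mul_sum]
        refine Finset.sum_congr rfl fun P _ => ?_
        simp only [← hP, Finset.mul_sum]
    _ = _ := by
        rw [hh, map_sum_smul_symMul, Finset.mul_sum]
        refine Finset.sum_congr rfl fun κ _ => ?_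
        rw [hD.sum_sign fun i => v (κ i)]
        ring

/-! ### Iterated derivatives -/

section IteratedDerivatives

variable {E : Type*} [NormedAddCommGroup E] [NormedSpace ℝ E]

/-- The iterated directional derivative of `f` along the vectors in a list; in contrast with
`iteratedFDeriv`, its symmetry is an induction on `List.Perm`. -/
def iterDirDeriv (f : E → ℝ) : List E → E → ℝ
  | [] => f
  | v :: l => fun p => fderiv ℝ (iterDirDeriv f l) p v

theorem contDiffOn_iterDirDeriv {f : E → ℝ} {U : Set E} (hU : IsOpen U)
    (hf : ContDiffOn ℝ ∞ f U) (l : List E) : ContDiffOn ℝ ∞ (iterDirDeriv f l) U := by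
  induction l with
  | nil => exact hf
  | cons v l ih => exact (ih.fderiv_of_isOpen hU le_rfl).clm_apply contDiffOn_const

theorem fderiv_congr_of_eqOn {f g : E → ℝ} {U : Set E} (hU : IsOpen U) (h : Set.EqOn f g U)
    {p : E} (hp : p ∈ U) : fderiv ℝ f p = fderiv ℝ g p :=
  (h.eventuallyEq_of_mem (hU.mem_nhds hp)).fderiv_eq

theorem fderiv_fderiv_apply {f : E → ℝ} {p : E} (hf : ContDiffAt ℝ ∞ f p) (v w : E) :
    fderiv ℝ (fun q => fderiv ℝ f q w) p v = fderiv ℝ (fderiv ℝ f) p v w := by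
  have h : DifferentiableAt ℝ (fderiv ℝ f) p :=
    (hf.fderiv_right (m := ∞) (by simp)).differentiableAt (by simp)
  rw [fderiv_clm_apply h (differentiableAt_const w)]
  simp

theorem fderiv_fderiv_comm {f : E → ℝ} {p : E} (hf : ContDiffAt ℝ ∞ f p) (v w : E) :
    fderiv ℝ (fderiv ℝ f) p v w = fderiv ℝ (fderiv ℝ f) p w v :=
  (hf.isSymmSndFDerivAt (by
    rw [minSmoothness_of_isRCLikeNormedField]
    exact WithTop.coe_le_coe.2 le_top)).eq v w

theorem iterDirDeriv_perm {f : E → ℝ} {U : Set E} (hU : IsOpen U) (hf : ContDiffOn ℝ ∞ f U)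
    {l l' : List E} (h : l.Perm l') : Set.EqOn (iterDirDeriv f l) (iterDirDeriv f l') U := by
  induction h with
  | nil => exact fun _ _ => rfl
  | cons v _ ih =>
    intro p hp
    change fderiv ℝ _ p v = fderiv ℝ _ p v
    rw [fderiv_congr_of_eqOn hU ih hp]
  | swap v w l =>
    intro p hp
    have h := (contDiffOn_iterDirDeriv hU hf l).contDiffAt (hU.mem_nhds hp)
    change fderiv ℝ (fun q => fderiv ℝ _ q _) p _ = fderiv ℝ (fun q => fderiv ℝ _ q _) p _
    rw [fderiv_fderiv_apply h, fderiv_fderiv_apply h, fderiv_fderiv_comm h]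
  | trans _ _ ih₁ ih₂ => exact ih₁.trans ih₂

theorem differentiableAt_iteratedFDeriv {f : E → ℝ} {p : E} (hf : ContDiffAt ℝ ∞ f p) (r : ℕ) :
    DifferentiableAt ℝ (iteratedFDeriv ℝ r f) p :=
  (hf.iteratedFDeriv_right (m := 1) (i := r) (by exact_mod_cast le_top)).differentiableAt
    one_ne_zero

theorem fderiv_iteratedFDeriv_apply {f : E → ℝ} {p : E} (hf : ContDiffAt ℝ ∞ f p) {r : ℕ}
    (m : Fin (r + 1) → E) :
    fderiv ℝ (fun q => iteratedFDeriv ℝ r f q (Fin.tail m)) p (m 0)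
      = iteratedFDeriv ℝ (r + 1) f p m := by
  rw [iteratedFDeriv_succ_apply_left]
  have h := ((ContinuousMultilinearMap.apply ℝ (fun _ : Fin r => E) ℝ (Fin.tail m)).hasFDerivAt.comp
    p (differentiableAt_iteratedFDeriv hf r).hasFDerivAt).fderiv
  exact congrArg (fun T : E →L[ℝ] ℝ => T (m 0)) h

theorem iteratedFDeriv_apply_eq_iterDirDeriv {f : E → ℝ} {U : Set E} (hU : IsOpen U)
    (hf : ContDiffOn ℝ ∞ f U) {r : ℕ} (m : Fin r → E) :
    Set.EqOn (fun p => iteratedFDeriv ℝ r f p m) (iterDirDeriv f (List.ofFn m)) U := by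
  induction r with
  | zero => intro p _; simp [iterDirDeriv]
  | succ r ih =>
    intro p hp
    have h := fderiv_congr_of_eqOn hU (ih (Fin.tail m)) hp
    rw [List.ofFn_succ]
    change _ = fderiv ℝ (iterDirDeriv f (List.ofFn (Fin.tail m))) p (m 0)
    rw [← h, fderiv_iteratedFDeriv_apply (hf.contDiffAt (hU.mem_nhds hp))]

/-- The iterated derivatives of a smooth function are symmetric. -/
theorem iteratedFDeriv_comp_perm {f : E → ℝ} {U : Set E} (hU : IsOpen U)
    (hf : ContDiffOn ℝ ∞ f U) {p : E} (hp : p ∈ U) {r : ℕ} (m : Fin r → E)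
    (P : Equiv.Perm (Fin r)) : iteratedFDeriv ℝ r f p (m ∘ P) = iteratedFDeriv ℝ r f p m := by
  have h1 := iteratedFDeriv_apply_eq_iterDirDeriv hU hf (m ∘ P) hp
  have h2 := iteratedFDeriv_apply_eq_iterDirDeriv hU hf m hp
  exact h1.trans ((iterDirDeriv_perm hU hf (P.ofFn_comp_perm m) hp).trans h2.symm)

/-- Taylor's formula for a smooth function whose derivatives of order `n + 1` vanish along a line:
the sum `∑_r (1 - t)^r / r! D^r f(p + t v)(v, …, v)` does not depend on `t`. -/
theorem eq_sum_iteratedFDeriv {f : E → ℝ} {p v : E} (hf : ∀ t : ℝ, ContDiffAt ℝ ∞ f (p + t • v))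
    (hn : ∀ t : ℝ, iteratedFDeriv ℝ (n + 1) f (p + t • v) (fun _ => v) = 0) :
    f (p + v) = ∑ r ∈ Finset.range (n + 1),
      (1 / (r.factorial : ℝ)) * iteratedFDeriv ℝ r f p fun _ => v := by
  set g : ℕ → ℝ → ℝ := fun r t => iteratedFDeriv ℝ r f (p + t • v) fun _ => v with hg
  have hderiv : ∀ r t, HasDerivAt (g r) (g (r + 1) t) t := by
    intro r t
    have hline : HasDerivAt (fun t : ℝ => p + t • v) v t := by
      simpa using ((hasDerivAt_id t).smul_const v).const_add p
    have hd : DifferentiableAt ℝ (fun q => iteratedFDeriv ℝ r f q fun _ => v) (p + t • v) :=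
      ((ContinuousMultilinearMap.apply ℝ (fun _ : Fin r => E) ℝ
        fun _ => v).differentiableAt.comp _ (differentiableAt_iteratedFDeriv (hf t) r))
    have h := hd.hasFDerivAt.comp_hasDerivAt t hline
    have h' := fderiv_iteratedFDeriv_apply (hf t) (r := r) fun _ => v
    rw [show Fin.tail (fun _ : Fin (r + 1) => v) = fun _ => v from rfl] at h'
    rw [h'] at h
    exact h
  have hsum : ∀ N t, HasDerivAt
      (fun t => ∑ r ∈ Finset.range (N + 1), (1 - t) ^ r / (r.factorial : ℝ) * g r t)
      ((1 - t) ^ N / (N.factorial : ℝ) * g (N + 1) t) t := by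
    intro N t
    induction N with
    | zero => simpa using hderiv 0 t
    | succ N ih =>
      simp only [Finset.sum_range_succ _ (N + 1)]
      have h1 : HasDerivAt (fun t : ℝ => (1 - t) ^ (N + 1) / ((N + 1).factorial : ℝ))
          (-((1 - t) ^ N / (N.factorial : ℝ))) t := by
        have h0 := ((((hasDerivAt_id t).const_sub 1).pow (N + 1)).div_const
          ((N + 1).factorial : ℝ))
        refine h0.congr_deriv ?_
        rw [Nat.factorial_succ]
        push_cast
        have : (N : ℝ) + 1 ≠ 0 := by positivity
        simp only [id]
        field_simp
      refine (ih.add (h1.mul (hderiv (N + 1) t))).congr_deriv ?_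
      ring
  have hconst := is_const_of_deriv_eq_zero (fun t => (hsum n t).differentiableAt)
    (fun t => by rw [(hsum n t).deriv]; simp only [hg, hn, mul_zero]) 1 0
  have h1 : ∑ r ∈ Finset.range (n + 1), (1 - 1 : ℝ) ^ r / (r.factorial : ℝ) * g r 1 = f (p + v) := by
    rw [Finset.sum_range_succ', Finset.sum_eq_zero]
    · simp [hg]
    · intro r _; simp
  rw [← h1]
  simpa [hg] using hconst

end IteratedDerivatives

/-! ### Derivatives along the second derivative coordinates -/

theorem isOpen_jetDomain {V : Set ((Fin n → ℝ) × ℝ)} (hV : IsOpen V) : IsOpen (jetDomain V) :=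
  hV.preimage continuous_fst

/-- The inclusion of the second derivative directions into the tangent space of the jet space. -/
def fiberIncl : (Sym2 (Fin n) → ℝ) →L[ℝ] Jet2 n :=
  (ContinuousLinearMap.inr ℝ ((Fin n → ℝ) × ℝ) ((Fin n → ℝ) × (Sym2 (Fin n) → ℝ))).comp
    (ContinuousLinearMap.inr ℝ (Fin n → ℝ) (Sym2 (Fin n) → ℝ))

theorem fiberIncl_apply (h : Sym2 (Fin n) → ℝ) : fiberIncl h = ((0, 0, h) : Jet2 n) := rfl

/-- The factor in `∂^{μν}` makes it the derivative along `e_μ ⊙ e_ν`. -/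
theorem dSecond_eq (μ ν : Fin n) (f : Jet2 n → ℝ) (p : Jet2 n) :
    dSecond μ ν f p = fderiv ℝ f p (fiberIncl (symMul (unitVec μ) (unitVec ν))) := by
  rw [symMul_unitVec, map_smul, map_smul]
  rfl

theorem dSecond_dSecond_eq {f : Jet2 n → ℝ} {p : Jet2 n} (hf : ContDiffAt ℝ ∞ f p)
    (μ ν ρ σ : Fin n) : dSecond μ ν (dSecond ρ σ f) p = fderiv ℝ (fderiv ℝ f) p
      (fiberIncl (symMul (unitVec μ) (unitVec ν))) (fiberIncl (symMul (unitVec ρ) (unitVec σ))) := by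
  rw [dSecond_eq, show dSecond ρ σ f = fun q => fderiv ℝ f q _ from funext (dSecond_eq ρ σ f),
    fderiv_fderiv_apply hf]

theorem symMul_add_left (a a' b : Fin n → ℝ) :
    symMul (a + a') b = symMul a b + symMul a' b := by
  ext s
  induction s with
  | _ i j => simp only [Pi.add_apply, symMul_mk]; ring

theorem symMul_smul_left (t : ℝ) (a b : Fin n → ℝ) : symMul (t • a) b = t • symMul a b := by
  ext s
  induction s with
  | _ i j => simp only [Pi.smul_apply, symMul_mk, smul_eq_mul]; ring

theorem symMul_add_right (a b b' : Fin n → ℝ) :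
    symMul a (b + b') = symMul a b + symMul a b' := by
  rw [symMul_comm, symMul_add_left, symMul_comm b, symMul_comm b']

theorem symMul_smul_right (t : ℝ) (a b : Fin n → ℝ) : symMul a (t • b) = t • symMul a b := by
  rw [symMul_comm, symMul_smul_left, symMul_comm]

theorem eq_zero_of_isLinearMap {T : (Fin n → ℝ) → ℝ} (hT : IsLinearMap ℝ T)
    (h : ∀ i, T (unitVec i) = 0) (a : Fin n → ℝ) : T a = 0 := by
  have : IsLinearMap.mk' T hT = 0 := LinearMap.pi_ext' fun i => by
    ext
    simpa using h i
  exact congrArg (fun F : (Fin n → ℝ) →ₗ[ℝ] ℝ => F a) this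

/-- The triviality equation for unit vectors extends to all vectors. -/
theorem cyclic_sum_eq_zero {B : (Sym2 (Fin n) → ℝ) → (Sym2 (Fin n) → ℝ) → ℝ}
    (hl : ∀ y, IsLinearMap ℝ fun x => B x y) (hr : ∀ x, IsLinearMap ℝ (B x))
    (h : ∀ μ ρ₁ ρ₂ ρ₃ : Fin n,
      B (symMul (unitVec μ) (unitVec ρ₁)) (symMul (unitVec ρ₂) (unitVec ρ₃))
      + B (symMul (unitVec μ) (unitVec ρ₂)) (symMul (unitVec ρ₃) (unitVec ρ₁))
      + B (symMul (unitVec μ) (unitVec ρ₃)) (symMul (unitVec ρ₁) (unitVec ρ₂)) = 0)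
    (a b c d : Fin n → ℝ) :
    B (symMul a b) (symMul c d) + B (symMul a c) (symMul d b) + B (symMul a d) (symMul b c) = 0 := by
  have hla := fun x x' y => (hl y).map_add x x'
  have hls := fun (t : ℝ) x y => (hl y).map_smul t x
  have hra := fun x y y' => (hr x).map_add y y'
  have hrs := fun (t : ℝ) x y => (hr x).map_smul t y
  beta_reduce at hla hls
  refine eq_zero_of_isLinearMap (T := fun a => B (symMul a b) (symMul c d)
    + B (symMul a c) (symMul d b) + B (symMul a d) (symMul b c)) ⟨fun _ _ => ?_, fun _ _ => ?_⟩
    (fun μ => ?_) a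
  · simp only [symMul_add_left, hla]; ring
  · simp only [symMul_smul_left, hls, smul_eq_mul]; ring
  refine eq_zero_of_isLinearMap (T := fun b => B (symMul (unitVec μ) b) (symMul c d)
    + B (symMul (unitVec μ) c) (symMul d b) + B (symMul (unitVec μ) d) (symMul b c))
    ⟨fun _ _ => ?_, fun _ _ => ?_⟩ (fun ρ₁ => ?_) b
  · simp only [symMul_add_left, symMul_add_right, hla, hra]; ring
  · simp only [symMul_smul_left, symMul_smul_right, hls, hrs, smul_eq_mul]; ring
  refine eq_zero_of_isLinearMap (T := fun c => B (symMul (unitVec μ) (unitVec ρ₁)) (symMul c d)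
    + B (symMul (unitVec μ) c) (symMul d (unitVec ρ₁))
    + B (symMul (unitVec μ) d) (symMul (unitVec ρ₁) c))
    ⟨fun _ _ => ?_, fun _ _ => ?_⟩ (fun ρ₂ => ?_) c
  · simp only [symMul_add_left, symMul_add_right, hla, hra]; ring
  · simp only [symMul_smul_left, symMul_smul_right, hls, hrs, smul_eq_mul]; ring
  refine eq_zero_of_isLinearMap (T := fun d =>
    B (symMul (unitVec μ) (unitVec ρ₁)) (symMul (unitVec ρ₂) d)
    + B (symMul (unitVec μ) (unitVec ρ₂)) (symMul d (unitVec ρ₁))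
    + B (symMul (unitVec μ) d) (symMul (unitVec ρ₁) (unitVec ρ₂)))
    ⟨fun _ _ => ?_, fun _ _ => ?_⟩ (fun ρ₃ => ?_) d
  · simp only [symMul_add_left, symMul_add_right, hla, hra]; ring
  · simp only [symMul_smul_left, symMul_smul_right, hls, hrs, smul_eq_mul]; ring
  exact h μ ρ₁ ρ₂ ρ₃

/-- The `r`-th derivative of `L` at `p` in the second derivative directions. -/
def fiberForm (r : ℕ) (L : Jet2 n → ℝ) (p : Jet2 n) :
    MultilinearMap ℝ (fun _ : Fin r => Sym2 (Fin n) → ℝ) ℝ :=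
  (iteratedFDeriv ℝ r L p).toMultilinearMap.compLinearMap fun _ => fiberIncl.toLinearMap

theorem fiberForm_apply (r : ℕ) (L : Jet2 n → ℝ) (p : Jet2 n) (m : Fin r → Sym2 (Fin n) → ℝ) :
    fiberForm r L p m = iteratedFDeriv ℝ r L p fun i => fiberIncl (m i) := rfl

theorem fiberForm_comp_perm {L : Jet2 n → ℝ} {U : Set (Jet2 n)} (hU : IsOpen U)
    (hL : ContDiffOn ℝ ∞ L U) {p : Jet2 n} (hp : p ∈ U) {r : ℕ} (m : Fin r → Sym2 (Fin n) → ℝ)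
    (P : Equiv.Perm (Fin r)) : fiberForm r L p (m ∘ P) = fiberForm r L p m :=
  iteratedFDeriv_comp_perm hU hL hp (fun i => fiberIncl (m i)) P

theorem iteratedFDeriv_add_two_apply (f : Jet2 n → ℝ) (p : Jet2 n) {r : ℕ}
    (m : Fin (r + 2) → Jet2 n) :
    iteratedFDeriv ℝ (r + 2) f p m = iteratedFDeriv ℝ r (fderiv ℝ (fderiv ℝ f)) p
      (Fin.init (Fin.init m)) (m (Fin.last r).castSucc) (m (Fin.last (r + 1))) := by
  rw [iteratedFDeriv_succ_apply_right, iteratedFDeriv_succ_apply_right]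
  rfl

theorem injective_pair {ι : Type*} {i j : ι} (h : i ≠ j) : Function.Injective ![i, j] := by
  intro k l hkl
  fin_cases k <;> fin_cases l <;> simp_all

/-- The triviality equation passes to all higher derivatives: they are symmetric, and the equation
for the last two slots holds on an open set. -/
theorem isTrivialForm_fiberForm {V : Set ((Fin n → ℝ) × ℝ)} (hV : IsOpen V) {L : Jet2 n → ℝ}
    (hL : ContDiffOn ℝ ∞ L (jetDomain V)) (h : SolvesTrivialityEquation V L) {p : Jet2 n}
    (hp : p ∈ jetDomain V) (r : ℕ) : IsTrivialForm (fiberForm r L p) := by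
  have hU := isOpen_jetDomain hV
  intro i j hij m a b c
  obtain ⟨r, rfl⟩ : ∃ k, r = k + 2 := by
    refine Nat.exists_eq_add_of_le' ?_
    have := Fin.val_ne_of_ne hij
    omega
  -- By symmetry the slots `i` and `j` may be taken to be the last two.
  obtain ⟨P, hP⟩ := exists_perm_comp_eq (f := ![(Fin.last r).castSucc, Fin.last (r + 1)])
    (g := ![i, j]) (injective_pair (Fin.castSucc_lt_last _).ne) (injective_pair hij)
  have hPi : P (Fin.last r).castSucc = i := (congrFun hP 0).symm
  have hPj : P (Fin.last (r + 1)) = j := (congrFun hP 1).symm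
  have key : ∀ x y, fiberForm (r + 2) L p (Function.update (Function.update m i x) j y)
      = iteratedFDeriv ℝ r (fderiv ℝ (fderiv ℝ L)) p
        (fun k => fiberIncl (m (P k.castSucc.castSucc))) (fiberIncl x) (fiberIncl y) := by
    intro x y
    rw [← fiberForm_comp_perm hU hL hp _ P, fiberForm_apply, iteratedFDeriv_add_two_apply]
    simp only [Function.comp_apply, hPi, hPj, Function.update_self, Function.update_of_ne hij]
    congr 3
    funext k
    have h1 : P k.castSucc.castSucc ≠ i := by
      rw [← hPi]
      exact fun h => (Fin.castSucc_lt_last k).ne (Fin.castSucc_injective _ (P.injective h))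
    have h2 : P k.castSucc.castSucc ≠ j := by
      rw [← hPj]
      exact fun h => (Fin.castSucc_lt_last _).ne (P.injective h)
    simp only [Fin.init, Function.update_of_ne h1, Function.update_of_ne h2]
  -- The equation in the last two slots, as a linear functional `Λ` of the second derivative: it
  -- vanishes on an open set, hence so do the derivatives of `Λ ∘ D²L`.
  set Λ : (Jet2 n →L[ℝ] Jet2 n →L[ℝ] ℝ) →L[ℝ] ℝ :=
    ((ContinuousLinearMap.apply ℝ ℝ (fiberIncl (symMul b c))).comp
      (ContinuousLinearMap.apply ℝ (Jet2 n →L[ℝ] ℝ) (fiberIncl (symMul a a))))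
    + (2 : ℝ) • ((ContinuousLinearMap.apply ℝ ℝ (fiberIncl (symMul a c))).comp
      (ContinuousLinearMap.apply ℝ (Jet2 n →L[ℝ] ℝ) (fiberIncl (symMul a b)))) with hΛ
  have hΛapp : ∀ B : Jet2 n →L[ℝ] Jet2 n →L[ℝ] ℝ, Λ B
      = B (fiberIncl (symMul a a)) (fiberIncl (symMul b c))
        + 2 * B (fiberIncl (symMul a b)) (fiberIncl (symMul a c)) := fun B => rfl
  have hzero : Set.EqOn (Λ ∘ fderiv ℝ (fderiv ℝ L)) 0 (jetDomain V) := by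
    intro q hq
    have hLq := hL.contDiffAt (hU.mem_nhds hq)
    have hcyc := cyclic_sum_eq_zero
      (B := fun x y => fderiv ℝ (fderiv ℝ L) q (fiberIncl x) (fiberIncl y))
      (fun y => ⟨fun x x' => by simp, fun t x => by simp⟩)
      (fun x => ⟨fun y y' => by simp, fun t y => by simp⟩)
      (fun μ ρ₁ ρ₂ ρ₃ => by simpa only [dSecond_dSecond_eq hLq] using h q hq μ ρ₁ ρ₂ ρ₃) a a b c
    beta_reduce at hcyc
    rw [symMul_comm c a, fderiv_fderiv_comm hLq (fiberIncl (symMul a c))] at hcyc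
    rw [Function.comp_apply, hΛapp, Pi.zero_apply]
    linarith
  have hd : ContDiffAt ℝ r (fderiv ℝ (fderiv ℝ L)) p := by
    have hLp := hL.contDiffAt (hU.mem_nhds hp)
    exact (hLp.fderiv_right (m := ∞) (by simp)).fderiv_right (by exact_mod_cast le_top)
  have hit := Λ.iteratedFDeriv_comp_left hd (le_refl (r : WithTop ℕ∞))
  have h0 := (hzero.eventuallyEq_of_mem (hU.mem_nhds hp)).iteratedFDeriv ℝ r
  rw [key, key]
  have := congrArg (fun T => T fun k => fiberIncl (m (P k.castSucc.castSucc)))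
    (hit.symm.trans h0.eq_of_nhds)
  simpa [hΛapp] using this

/-! ### The coefficients of a trivial Lagrangian -/

/-- The jet with the same lower order coordinates and vanishing second derivatives. -/
def zeroFiber (p : Jet2 n) : Jet2 n := (p.1, p.2.1, 0)

theorem contDiff_zeroFiber : ContDiff ℝ ∞ (zeroFiber (n := n)) :=
  contDiff_fst.prodMk ((contDiff_fst.comp contDiff_snd).prodMk contDiff_const)

theorem zeroFiber_add_fiberIncl (p : Jet2 n) (h : Sym2 (Fin n) → ℝ) :
    zeroFiber (p + fiberIncl h) = zeroFiber p := by
  simp [zeroFiber, fiberIncl_apply]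

theorem zeroFiber_add_self (p : Jet2 n) : zeroFiber p + fiberIncl p.2.2 = p := by
  simp [zeroFiber, fiberIncl_apply]

theorem add_fiberIncl_mem {V : Set ((Fin n → ℝ) × ℝ)} {p : Jet2 n} (hp : p ∈ jetDomain V)
    (h : Sym2 (Fin n) → ℝ) : p + fiberIncl h ∈ jetDomain V := by
  change p.1 + 0 ∈ V
  rwa [add_zero]

theorem fderiv_apply_eq_zero_of_const {E : Type*} [NormedAddCommGroup E] [NormedSpace ℝ E]
    {f : E → ℝ} {p v : E} (h : ∀ t : ℝ, f (p + t • v) = f p) : fderiv ℝ f p v = 0 := by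
  by_cases hf : DifferentiableAt ℝ f p
  · rw [← hf.lineDeriv_eq_fderiv, lineDeriv]
    simp [h]
  · rw [fderiv_zero_of_not_differentiableAt hf]
    rfl

/-- The coefficients of the expansion of `L`: up to normalization, the hyper-Jacobians with each
`ψ_{ρσ}` replaced by `∂^{ρσ}`, applied to `L` at vanishing second derivatives. -/
def expansionCoeff (L : Jet2 n → ℝ) : CoefficientFamily n := fun r σ τ p =>
  2 ^ (r : ℕ) / (((r : ℕ) + 1).factorial * (r : ℕ).factorial * epsilonNorm r) *
    ∑ α : Fin (r : ℕ) → Fin n, epsilon (joinIndices r α τ) *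
      fiberForm r L (zeroFiber p) fun i => symMul (unitVec (α i)) (unitVec (σ i))

theorem contDiffOn_expansionCoeff {V : Set ((Fin n → ℝ) × ℝ)} (hV : IsOpen V) {L : Jet2 n → ℝ}
    (hL : ContDiffOn ℝ ∞ L (jetDomain V)) (r : Fin (n + 1)) (σ : Fin (r : ℕ) → Fin n)
    (τ : Fin (n - (r : ℕ)) → Fin n) : ContDiffOn ℝ ∞ (expansionCoeff L r σ τ) (jetDomain V) := by
  have hU := isOpen_jetDomain hV
  have h : ∀ m : Fin (r : ℕ) → Jet2 n,
      ContDiffOn ℝ ∞ (fun p => iteratedFDeriv ℝ r L p m) (jetDomain V) := by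
    intro m p hp
    have h1 := (hL.contDiffAt (hU.mem_nhds hp)).iteratedFDeriv_right (m := ∞) (i := (r : ℕ))
      (by exact_mod_cast le_top)
    exact ((ContinuousMultilinearMap.apply ℝ (fun _ : Fin (r : ℕ) => Jet2 n) ℝ
      m).contDiff.contDiffAt.comp p h1).contDiffWithinAt
  refine contDiffOn_const.mul (ContDiffOn.sum fun α _ => contDiffOn_const.mul ?_)
  exact (h _).comp contDiff_zeroFiber.contDiffOn fun p hp => hp

theorem expansionCoeff_comp_perm {V : Set ((Fin n → ℝ) × ℝ)} (hV : IsOpen V) {L : Jet2 n → ℝ}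
    (hL : ContDiffOn ℝ ∞ L (jetDomain V)) (r : Fin (n + 1)) (σ : Fin (r : ℕ) → Fin n)
    (τ : Fin (n - (r : ℕ)) → Fin n) (P : Equiv.Perm (Fin (r : ℕ)))
    (Q : Equiv.Perm (Fin (n - (r : ℕ)))) {p : Jet2 n} (hp : p ∈ jetDomain V) :
    expansionCoeff L r (σ ∘ P) (τ ∘ Q) p
      = ((Equiv.Perm.sign P : ℤ) : ℝ) * ((Equiv.Perm.sign Q : ℤ) : ℝ)
        * expansionCoeff L r σ τ p := by
  rw [expansionCoeff, expansionCoeff, mul_left_comm]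
  congr 1
  rw [← Equiv.sum_comp (Equiv.arrowCongr P.symm (Equiv.refl (Fin n))), Finset.mul_sum]
  refine Finset.sum_congr rfl fun α _ => ?_
  have hα : (Equiv.arrowCongr P.symm (Equiv.refl (Fin n))) α = α ∘ P := rfl
  rw [hα, epsilon_joinIndices_comp, mul_assoc]
  congr 2
  exact fiberForm_comp_perm (isOpen_jetDomain hV) hL (p := zeroFiber p) hp
    (fun i => symMul (unitVec (α i)) (unitVec (σ i))) P

/-- The trace vanishes since the antisymmetric symbol is contracted with a symmetric product. -/
theorem sum_expansionCoeff_update (L : Jet2 n → ℝ) (r : Fin (n + 1)) (σ : Fin (r : ℕ) → Fin n)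
    (τ : Fin (n - (r : ℕ)) → Fin n) (i : Fin (r : ℕ)) (j : Fin (n - (r : ℕ))) (p : Jet2 n) :
    ∑ ζ : Fin n, expansionCoeff L r (Function.update σ i ζ) (Function.update τ j ζ) p = 0 := by
  simp only [expansionCoeff, ← Finset.mul_sum]
  refine mul_eq_zero_of_right _ ?_
  rw [← Fintype.sum_prod_type' (f := fun (ζ : Fin n) (α : Fin (r : ℕ) → Fin n) =>
    epsilon (joinIndices r α (Function.update τ j ζ)) *
    fiberForm r L (zeroFiber p) fun k => symMul (unitVec (α k))
      (unitVec (Function.update σ i ζ k)))]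
  set F : Fin n × (Fin (r : ℕ) → Fin n) → ℝ := fun x =>
    epsilon (joinIndices r x.2 (Function.update τ j x.1)) *
    fiberForm r L (zeroFiber p) fun k => symMul (unitVec (x.2 k))
      (unitVec (Function.update σ i x.1 k)) with hF
  -- Exchange the summation index `ζ` with `α_i`.
  let e : Fin n × (Fin (r : ℕ) → Fin n) → Fin n × (Fin (r : ℕ) → Fin n) :=
    fun x => (x.2 i, Function.update x.2 i x.1)
  have he : Function.Involutive e := fun x => by simp [e]
  have hneg : ∀ x, F (Function.Involutive.toPerm e he x) = -F x := by
    rintro ⟨ζ, α⟩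
    have h1 : joinIndices r (Function.update α i ζ) (Function.update τ j (α i))
        = joinIndices r α (Function.update τ j ζ)
          ∘ Equiv.swap (splitEquiv r (Sum.inl i)) (splitEquiv r (Sum.inr j)) := by
      rw [joinIndices_eq, joinIndices_eq, Equiv.comp_symm_eq]
      funext k
      rw [Function.comp_assoc, Function.comp_apply, Function.comp_apply, Function.comp_apply,
        ← Equiv.symm_apply_apply (splitEquiv r) k]
      simp only [Equiv.symm_apply_apply]
      rcases k with k | k
      · by_cases hk : k = i
        · subst hk; simp
        · rw [Equiv.swap_apply_of_ne_of_ne (by simpa using hk) (by simp)]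
          simp [hk]
      · by_cases hk : k = j
        · subst hk; simp
        · rw [Equiv.swap_apply_of_ne_of_ne (by simp) (by simpa using hk)]
          simp [hk]
    have h2 : (fun k => symMul (unitVec (Function.update α i ζ k))
          (unitVec (Function.update σ i (α i) k)))
        = fun k => symMul (unitVec (α k)) (unitVec (Function.update σ i ζ k)) := by
      funext k
      by_cases hk : k = i
      · subst hk; simp [symMul_comm]
      · simp [hk]
    change epsilon (joinIndices r (Function.update α i ζ) (Function.update τ j (α i))) *
      fiberForm r L (zeroFiber p) (fun k => symMul (unitVec (Function.update α i ζ k))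
          (unitVec (Function.update σ i (α i) k))) = _
    rw [h1, h2, epsilon_comp_perm, Equiv.Perm.sign_swap (by simp)]
    simp [hF]
  have hsum := Equiv.sum_comp (Function.Involutive.toPerm e he) F
  simp only [hneg, Finset.sum_neg_distrib] at hsum
  linarith

theorem isAdmissible_expansionCoeff {V : Set ((Fin n → ℝ) × ℝ)} (hV : IsOpen V)
    {L : Jet2 n → ℝ} (hL : ContDiffOn ℝ ∞ L (jetDomain V)) :
    IsAdmissible V (expansionCoeff L) where
  smooth := contDiffOn_expansionCoeff hV hL
  independent r σ τ μ ν p _ := by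
    rw [dSecond_eq]
    refine fderiv_apply_eq_zero_of_const fun t => ?_
    rw [← map_smul, expansionCoeff, zeroFiber_add_fiberIncl]
    rfl
  antisymmetric r σ τ P Q p hp := expansionCoeff_comp_perm hV hL r σ τ P Q hp
  traceless r σ τ i j _ _ p _ := sum_expansionCoeff_update L r σ τ i j p

/-- The degree `r` part of the expansion is the degree `r` term of the Taylor series of `L` in the
second derivatives. -/
theorem sum_expansionCoeff_mul_hyperJacobian {L : Jet2 n → ℝ} (r : Fin (n + 1)) {p : Jet2 n}
    (hD : IsTrivialForm (fiberForm r L (zeroFiber p))) :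
    ∑ σ : Fin (r : ℕ) → Fin n, ∑ τ : Fin (n - (r : ℕ)) → Fin n,
      expansionCoeff L r σ τ p * hyperJacobian r σ τ p
    = 1 / ((r : ℕ).factorial : ℝ) * fiberForm r L (zeroFiber p) fun _ => p.2.2 := by
  have hσ : ∀ σ : Fin (r : ℕ) → Fin n, ∑ τ : Fin (n - (r : ℕ)) → Fin n,
      (∑ α : Fin (r : ℕ) → Fin n, epsilon (joinIndices r α τ) *
        fiberForm r L (zeroFiber p) fun i => symMul (unitVec (α i)) (unitVec (σ i))) *
          hyperJacobian r σ τ p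
      = epsilonNorm r * ∑ β : Fin (r : ℕ) → Fin n, (∏ i, p.2.2 s(β i, σ i)) *
        ∑ P : Equiv.Perm (Fin (r : ℕ)), ((Equiv.Perm.sign P : ℤ) : ℝ) *
          fiberForm r L (zeroFiber p) (fun i => symMul (unitVec (β (P i))) (unitVec (σ i))) := by
    intro σ
    have hβ := fun β => sum_epsilon_mul_epsilon r β fun α =>
      fiberForm r L (zeroFiber p) fun i => symMul (unitVec (α i)) (unitVec (σ i))
    simp only [Function.comp_apply] at hβ
    rw [Finset.mul_sum]
    simp only [mul_left_comm (epsilonNorm r), ← hβ, hyperJacobian, psi2, Finset.sum_mul_sum]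
    simp only [Finset.sum_mul, Finset.mul_sum]
    rw [Finset.sum_comm]
    rw [Finset.sum_congr rfl fun (α : Fin (r : ℕ) → Fin n) _ => Finset.sum_comm, Finset.sum_comm]
    refine Finset.sum_congr rfl fun β _ => Finset.sum_congr rfl fun α _ =>
      Finset.sum_congr rfl fun τ _ => by ring
  have hN := (epsilonNorm_pos r).ne'
  have h1 : (((r : ℕ) + 1).factorial : ℝ) ≠ 0 := by positivity
  have h2 : ((r : ℕ).factorial : ℝ) ≠ 0 := by positivity
  simp only [expansionCoeff, mul_assoc, ← Finset.mul_sum]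
  rw [Finset.sum_congr rfl fun σ _ => hσ σ, ← Finset.mul_sum, Finset.sum_comm,
    hD.sum_sign_diagonal]
  field_simp

theorem isExpansion_expansionCoeff {V : Set ((Fin n → ℝ) × ℝ)} (hV : IsOpen V)
    {L : Jet2 n → ℝ} (hL : ContDiffOn ℝ ∞ L (jetDomain V)) (h : SolvesTrivialityEquation V L) :
    IsExpansion V L (expansionCoeff L) := by
  have hU := isOpen_jetDomain hV
  intro p hp
  have hp0 : zeroFiber p ∈ jetDomain V := hp
  have hmem : ∀ t : ℝ, zeroFiber p + t • fiberIncl p.2.2 ∈ jetDomain V := fun t => by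
    rw [← map_smul]
    exact add_fiberIncl_mem hp0 _
  have htaylor := eq_sum_iteratedFDeriv (n := n) (fun t => hL.contDiffAt (hU.mem_nhds (hmem t)))
    fun t => (isTrivialForm_fiberForm hV hL h (hmem t) (n + 1)).diagonal_eq_zero
      (Nat.lt_succ_self n) p.2.2
  rw [zeroFiber_add_self, Finset.sum_range] at htaylor
  rw [htaylor]
  refine Finset.sum_congr rfl fun r _ => ?_
  rw [sum_expansionCoeff_mul_hyperJacobian r (isTrivialForm_fiberForm hV hL h hp0 r)]
  rfl

/-! ### Hyper-Jacobians and the triviality equation -/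

/-- Admissible coefficients are constant along the fibres over the lower order coordinates, which
are whole vector spaces. -/
theorem IsAdmissible.apply_add_fiberIncl {V : Set ((Fin n → ℝ) × ℝ)} (hV : IsOpen V)
    {c : CoefficientFamily n} (hc : IsAdmissible V c) (r : Fin (n + 1))
    (σ : Fin (r : ℕ) → Fin n) (τ : Fin (n - (r : ℕ)) → Fin n) {p : Jet2 n}
    (hp : p ∈ jetDomain V) (h : Sym2 (Fin n) → ℝ) : c r σ τ (p + fiberIncl h) = c r σ τ p := by
  have hU := isOpen_jetDomain hV
  have hmem : ∀ t : ℝ, p + t • fiberIncl h ∈ jetDomain V := fun t => by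
    rw [← map_smul]
    exact add_fiberIncl_mem hp _
  have hline : ∀ t : ℝ, HasDerivAt (fun t : ℝ => p + t • fiberIncl h) (fiberIncl h) t := fun t => by
    simpa using ((hasDerivAt_id t).smul_const (fiberIncl h)).const_add p
  have hd : ∀ t : ℝ, HasDerivAt (fun t : ℝ => c r σ τ (p + t • fiberIncl h)) 0 t := by
    intro t
    have hdiff := ((hc.smooth r σ τ).contDiffAt (hU.mem_nhds (hmem t))).differentiableAt (by simp)
    refine (hdiff.hasFDerivAt.comp_hasDerivAt t (hline t)).congr_deriv ?_
    have hq := hmem t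
    generalize p + t • fiberIncl h = q at hq ⊢
    rw [eq_sum_symMul_unitVec h, map_sum, map_sum]
    refine Finset.sum_eq_zero fun x _ => ?_
    rw [map_smul, map_smul, ← dSecond_eq, hc.independent r σ τ _ _ _ hq, smul_zero]
  have := is_const_of_deriv_eq_zero (fun t => (hd t).differentiableAt) (fun t => (hd t).deriv) 1 0
  simpa using this

theorem fderiv_apply_eq_of_line {E : Type*} [NormedAddCommGroup E] [NormedSpace ℝ E]
    {f g : E → ℝ} {p v : E} (hf : DifferentiableAt ℝ f p) (hg : DifferentiableAt ℝ g p)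
    (h : ∀ t : ℝ, f (p + t • v) = g (p + t • v)) : fderiv ℝ f p v = fderiv ℝ g p v := by
  rw [← hf.lineDeriv_eq_fderiv, ← hg.lineDeriv_eq_fderiv, lineDeriv, lineDeriv, funext h]

theorem contDiffOn_dSecond {f : Jet2 n → ℝ} {U : Set (Jet2 n)} (hU : IsOpen U)
    (hf : ContDiffOn ℝ ∞ f U) (μ ν : Fin n) : ContDiffOn ℝ ∞ (dSecond μ ν f) U := by
  rw [show dSecond μ ν f = fun q => fderiv ℝ f q _ from funext (dSecond_eq μ ν f)]
  exact (hf.fderiv_of_isOpen hU (by simp)).clm_apply contDiffOn_const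

theorem contDiff_dSecond {f : Jet2 n → ℝ} (hf : ContDiff ℝ ∞ f) (μ ν : Fin n) :
    ContDiff ℝ ∞ (dSecond μ ν f) :=
  contDiffOn_univ.1 (contDiffOn_dSecond isOpen_univ hf.contDiffOn μ ν)

theorem dSecond_sum_const_mul {ι : Type*} [Fintype ι] (a : ι → ℝ) {f : ι → Jet2 n → ℝ}
    (hf : ∀ k, ContDiff ℝ ∞ (f k)) (μ ν : Fin n) :
    dSecond μ ν (fun p => ∑ k, a k * f k p) = fun p => ∑ k, a k * dSecond μ ν (f k) p := by
  funext p
  have h : ∀ k, DifferentiableAt ℝ (f k) p := fun k => (hf k).differentiable (by simp) p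
  simp only [dSecond_eq]
  rw [fderiv_fun_sum fun k _ => (h k).const_mul (a k), sum_apply]
  refine Finset.sum_congr rfl fun k _ => ?_
  rw [fderiv_const_mul (h k)]
  rfl

theorem dSecond_dSecond_sum_const_mul {ι : Type*} [Fintype ι] (a : ι → ℝ) {f : ι → Jet2 n → ℝ}
    (hf : ∀ k, ContDiff ℝ ∞ (f k)) (μ ν ρ σ : Fin n) (p : Jet2 n) :
    dSecond μ ν (dSecond ρ σ fun p => ∑ k, a k * f k p) p
      = ∑ k, a k * dSecond μ ν (dSecond ρ σ (f k)) p := by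
  rw [dSecond_sum_const_mul a hf, dSecond_sum_const_mul a fun k => contDiff_dSecond (hf k) ρ σ]

/-- The coordinate `ψ_{μν}` as a linear function on the jet space. -/
def psi2CLM (μ ν : Fin n) : Jet2 n →L[ℝ] ℝ :=
  (ContinuousLinearMap.proj s(μ, ν)).comp
    ((ContinuousLinearMap.snd ℝ (Fin n → ℝ) (Sym2 (Fin n) → ℝ)).comp
      (ContinuousLinearMap.snd ℝ ((Fin n → ℝ) × ℝ) ((Fin n → ℝ) × (Sym2 (Fin n) → ℝ))))

theorem psi2CLM_apply (μ ν : Fin n) (p : Jet2 n) : psi2CLM μ ν p = psi2 μ ν p := rfl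

theorem psi2CLM_fiberIncl (μ ν : Fin n) (h : Sym2 (Fin n) → ℝ) :
    psi2CLM μ ν (fiberIncl h) = h s(μ, ν) := rfl

theorem contDiff_prod_psi2 {r : ℕ} (α σ : Fin r → Fin n) (s : Finset (Fin r)) :
    ContDiff ℝ ∞ fun p : Jet2 n => ∏ i ∈ s, psi2 (α i) (σ i) p :=
  contDiff_prod fun i _ => (psi2CLM (α i) (σ i)).contDiff

theorem contDiff_hyperJacobian (r : Fin (n + 1)) (σ : Fin (r : ℕ) → Fin n)
    (τ : Fin (n - (r : ℕ)) → Fin n) : ContDiff ℝ ∞ (hyperJacobian r σ τ) :=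
  ContDiff.sum fun α _ => contDiff_const.mul (contDiff_prod_psi2 α σ _)

theorem dSecond_prod_psi2 {r : ℕ} (α σ : Fin r → Fin n) (s : Finset (Fin r)) (μ ν : Fin n) :
    dSecond μ ν (fun p : Jet2 n => ∏ i ∈ s, psi2 (α i) (σ i) p) = fun p => ∑ i ∈ s,
      symMul (unitVec μ) (unitVec ν) s(α i, σ i) * ∏ j ∈ s.erase i, psi2 (α j) (σ j) p := by
  funext p
  have h := HasFDerivAt.finsetProd (u := s) (x := p)
    fun i _ => (psi2CLM (α i) (σ i)).hasFDerivAt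
  rw [dSecond_eq]
  simp only [psi2CLM_apply] at h
  rw [h.fderiv, sum_apply]
  refine Finset.sum_congr rfl fun i _ => ?_
  rw [smul_apply, psi2CLM_fiberIncl, smul_eq_mul, mul_comm]

theorem dSecond_dSecond_prod_psi2 {r : ℕ} (α σ : Fin r → Fin n) (μ ν ρ κ : Fin n) (p : Jet2 n) :
    dSecond μ ν (dSecond ρ κ fun p : Jet2 n => ∏ i, psi2 (α i) (σ i) p) p
      = ∑ i, ∑ j, if i = j then 0 else symMul (unitVec ρ) (unitVec κ) s(α i, σ i)
        * symMul (unitVec μ) (unitVec ν) s(α j, σ j)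
        * ∏ k ∈ (Finset.univ.erase i).erase j, psi2 (α k) (σ k) p := by
  rw [dSecond_prod_psi2, dSecond_sum_const_mul _ fun i => contDiff_prod_psi2 α σ _]
  refine Finset.sum_congr rfl fun i _ => ?_
  rw [dSecond_prod_psi2, Finset.mul_sum, ← Finset.sum_erase_add _ _ (Finset.mem_univ i)]
  rw [if_pos rfl, add_zero]
  refine Finset.sum_congr rfl fun j hj => ?_
  rw [if_neg (Finset.ne_of_mem_erase hj).symm, mul_assoc]

/-- The second derivatives of a hyper-Jacobian contract `ε^{…α_i…α_j…}` with a form in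
`α_i, σ_i, α_j, σ_j`, and the cyclic sum makes this form symmetric in its four indices. -/
theorem solvesTrivialityEquation_hyperJacobian (V : Set ((Fin n → ℝ) × ℝ)) (r : Fin (n + 1))
    (σ : Fin (r : ℕ) → Fin n) (τ : Fin (n - (r : ℕ)) → Fin n) :
    SolvesTrivialityEquation V (hyperJacobian r σ τ) := by
  intro p _ μ ρ₁ ρ₂ ρ₃
  have hJ : hyperJacobian r σ τ = fun p => ∑ α : Fin (r : ℕ) → Fin n,
    epsilon (joinIndices r α τ) * ∏ i, psi2 (α i) (σ i) p := rfl
  have hsm := fun α : Fin (r : ℕ) → Fin n => contDiff_prod_psi2 α σ Finset.univ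
  simp only [hJ, dSecond_dSecond_sum_const_mul _ hsm, dSecond_dSecond_prod_psi2]
  simp only [← Finset.sum_add_distrib, ← mul_add]
  set S : Fin n → Fin n → Fin n → Fin n → ℝ := fun a b s t =>
    symMul (unitVec a) (unitVec b) s(s, t) with hS
  set R : (Fin (r : ℕ) → Fin n) → Fin (r : ℕ) → Fin (r : ℕ) → ℝ := fun α i j =>
    ∏ k ∈ (Finset.univ.erase i).erase j, psi2 (α k) (σ k) p with hR
  set X : (Fin (r : ℕ) → Fin n) → Fin (r : ℕ) → Fin (r : ℕ) → ℝ := fun α i j =>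
    S ρ₂ ρ₃ (α i) (σ i) * S μ ρ₁ (α j) (σ j) + S ρ₃ ρ₁ (α i) (σ i) * S μ ρ₂ (α j) (σ j)
      + S ρ₁ ρ₂ (α i) (σ i) * S μ ρ₃ (α j) (σ j) with hX
  -- The cyclic sum of `∂^{μρ₁} ∂^{ρ₂ρ₃} J` is `∑_{i,j} T i j`, and only `T i j + T j i` involves a
  -- form that is symmetric in all four indices.
  set T : Fin (r : ℕ) → Fin (r : ℕ) → ℝ := fun i j => if i = j then 0 else
    ∑ α : Fin (r : ℕ) → Fin n, epsilon (joinIndices r α τ) * (X α i j * R α i j) with hT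
  have hanti : ∀ i j, T i j + T j i = 0 := by
    intro i j
    by_cases hij : i = j
    · simp [hT, hij]
    have hRsymm : ∀ α, R α j i = R α i j := fun α => by
      simp only [hR, Finset.erase_right_comm]
    have hRswap : ∀ α, R (α ∘ Equiv.swap i j) i j = R α i j := by
      intro α
      refine Finset.prod_congr rfl fun k hk => ?_
      rw [Finset.mem_erase, Finset.mem_erase] at hk
      rw [Function.comp_apply, Equiv.swap_apply_of_ne_of_ne hk.2.1 hk.1]
    have hXswap : ∀ α, X (α ∘ Equiv.swap i j) i j + X (α ∘ Equiv.swap i j) j i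
        = X α i j + X α j i := by
      intro α
      simp only [hX, hS, symMul_mk, Function.comp_apply, Equiv.swap_apply_left,
        Equiv.swap_apply_right]
      ring
    simp only [hT, if_neg hij, if_neg (Ne.symm hij), ← Finset.sum_add_distrib, ← mul_add, hRsymm,
      ← add_mul]
    set G : (Fin (r : ℕ) → Fin n) → ℝ := fun α =>
      epsilon (joinIndices r α τ) * ((X α i j + X α j i) * R α i j) with hG
    have hsum := Equiv.sum_comp (Equiv.arrowCongr (Equiv.swap i j) (Equiv.refl (Fin n))) G
    have hneg : ∀ α, G ((Equiv.arrowCongr (Equiv.swap i j) (Equiv.refl (Fin n))) α) = -G α := by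
      intro α
      have hα : (Equiv.arrowCongr (Equiv.swap i j) (Equiv.refl (Fin n))) α
          = α ∘ Equiv.swap i j := rfl
      rw [hα, hG]
      simp only [hRswap, hXswap, epsilon_joinIndices_comp_left, Equiv.Perm.sign_swap hij]
      simp
    simp only [hneg, Finset.sum_neg_distrib] at hsum
    linarith
  have hTsum : ∑ i, ∑ j, T i j = 0 := by
    have h1 : ∑ i, ∑ j, T i j = ∑ i, ∑ j, T j i := Finset.sum_comm
    have h2 : ∑ i, ∑ j, (T i j + T j i) = 0 := by simp only [hanti, Finset.sum_const_zero]
    simp only [Finset.sum_add_distrib] at h2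
    linarith
  refine Eq.trans ?_ hTsum
  rw [Finset.sum_congr rfl fun (α : Fin (r : ℕ) → Fin n) _ => Finset.mul_sum _ _ _,
    Finset.sum_comm]
  refine Finset.sum_congr rfl fun i _ => ?_
  simp only [Finset.mul_sum]
  rw [Finset.sum_comm]
  refine Finset.sum_congr rfl fun j _ => ?_
  by_cases hij : i = j
  · simp [hT, hij]
  · simp only [hT, if_neg hij, hX, hS, hR]
    refine Finset.sum_congr rfl fun α _ => by ring

theorem IsExpansion.solvesTrivialityEquation {V : Set ((Fin n → ℝ) × ℝ)} (hV : IsOpen V)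
    {L : Jet2 n → ℝ} (hL : ContDiffOn ℝ ∞ L (jetDomain V)) {c : CoefficientFamily n}
    (hc : IsAdmissible V c) (h : IsExpansion V L c) : SolvesTrivialityEquation V L := by
  have hU := isOpen_jetDomain hV
  intro p hp μ ρ₁ ρ₂ ρ₃
  -- On the fibre through `p` the coefficients are constant, so that `L` agrees there with `M`.
  set M : Jet2 n → ℝ := fun q => ∑ k : Σ r : Fin (n + 1),
    (Fin (r : ℕ) → Fin n) × (Fin (n - (r : ℕ)) → Fin n),
      c k.1 k.2.1 k.2.2 p * hyperJacobian k.1 k.2.1 k.2.2 q with hM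
  have hJ := fun k : Σ r : Fin (n + 1), (Fin (r : ℕ) → Fin n) × (Fin (n - (r : ℕ)) → Fin n) =>
    contDiff_hyperJacobian k.1 k.2.1 k.2.2
  have hMs : ContDiff ℝ ∞ M := ContDiff.sum fun k _ => contDiff_const.mul (hJ k)
  have hLM : ∀ x, L (p + fiberIncl x) = M (p + fiberIncl x) := by
    intro x
    rw [h _ (add_fiberIncl_mem hp x), hM]
    simp only [hc.apply_add_fiberIncl hV _ _ _ hp, Fintype.sum_sigma, Fintype.sum_prod_type]
  have h1 : ∀ a b x, dSecond a b L (p + fiberIncl x) = dSecond a b M (p + fiberIncl x) := by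
    intro a b x
    rw [dSecond_eq, dSecond_eq]
    refine fderiv_apply_eq_of_line ((hL.contDiffAt (hU.mem_nhds
      (add_fiberIncl_mem hp x))).differentiableAt (by simp)) (hMs.differentiable (by simp) _)
      fun t => ?_
    rw [← map_smul, add_assoc, ← map_add]
    exact hLM _
  have h2 : ∀ a b d e, dSecond a b (dSecond d e L) p = dSecond a b (dSecond d e M) p := by
    intro a b d e
    rw [dSecond_eq a b (dSecond d e L), dSecond_eq a b (dSecond d e M)]
    refine fderiv_apply_eq_of_line (((contDiffOn_dSecond hU hL d e).contDiffAt
      (hU.mem_nhds hp)).differentiableAt (by simp))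
      ((contDiff_dSecond hMs d e).differentiable (by simp) _) fun t => ?_
    rw [← map_smul]
    exact h1 d e _
  rw [h2, h2, h2, hM]
  simp only [dSecond_dSecond_sum_const_mul _ hJ]
  simp only [← Finset.sum_add_distrib, ← mul_add]
  refine Finset.sum_eq_zero fun k _ => ?_
  rw [solvesTrivialityEquation_hyperJacobian V k.1 k.2.1 k.2.2 p hp, mul_zero]

/-! ### Bialternating arrays with the Bianchi identity -/

theorem cons_comp_swap_succ {r : ℕ} {A : Type*} (s : A) (σ : Fin r → A) (i j : Fin r) :
    (Fin.cons s σ : Fin (r + 1) → A) ∘ Equiv.swap i.succ j.succ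
      = Fin.cons s (σ ∘ Equiv.swap i j) := by
  funext k
  refine Fin.cases ?_ (fun k => ?_) k
  · rw [Function.comp_apply, Equiv.swap_apply_of_ne_of_ne (Fin.succ_ne_zero i).symm
      (Fin.succ_ne_zero j).symm, Fin.cons_zero, Fin.cons_zero]
  · rw [Function.comp_apply, Fin.cons_succ, Function.comp_apply,
      ← (Fin.succ_injective r).map_swap, Fin.cons_succ]

theorem cons_comp_swap_zero {r : ℕ} {A : Type*} (s : A) (σ : Fin r → A) (i : Fin r) :
    (Fin.cons s σ : Fin (r + 1) → A) ∘ Equiv.swap 0 i.succ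
      = Fin.cons (σ i) (Function.update σ i s) := by
  funext k
  refine Fin.cases ?_ (fun k => ?_) k
  · simp
  · by_cases hk : k = i
    · subst hk; simp
    · rw [Function.comp_apply, Equiv.swap_apply_of_ne_of_ne (Fin.succ_ne_zero k) (by simpa using hk)]
      simp [hk]

theorem sum_fin_succ_arrow {r : ℕ} (F : (Fin (r + 1) → Fin n) → ℝ) :
    ∑ σ, F σ = ∑ s : Fin n, ∑ σ : Fin r → Fin n, F (Fin.cons s σ) := by
  rw [← Equiv.sum_comp (Fin.consEquiv fun _ : Fin (r + 1) => Fin n), Fintype.sum_prod_type]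
  rfl

/-- An array `b(σ; α)`, antisymmetric in `σ` and in `α`, which satisfies the Bianchi identity
(antisymmetrization over `α` and one `σ_i` vanishes) and whose multilinear extension vanishes for
equal arguments `b(v_1, …, v_r; v_1, …, v_r) = 0`, is zero: by induction on `r` the array
`b(u, …; u, …)` vanishes for every vector `u`, so `b` changes its sign when an entry of `σ` is
exchanged with one of `α`, and the Bianchi identity becomes `b = -r b`. -/
theorem eq_zero_of_bianchi {r : ℕ} (b : (Fin r → Fin n) → (Fin r → Fin n) → ℝ)
    (hσ : ∀ σ α i j, i ≠ j → b (σ ∘ Equiv.swap i j) α = -b σ α)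
    (hα : ∀ σ α i j, i ≠ j → b σ (α ∘ Equiv.swap i j) = -b σ α)
    (hB : ∀ σ α i, b σ α = ∑ j, b (Function.update σ i (α j)) (Function.update α j (σ i)))
    (hv : ∀ v : Fin r → Fin n → ℝ,
      ∑ σ, ∑ α, b σ α * ((∏ i, v i (σ i)) * ∏ i, v i (α i)) = 0)
    (σ α : Fin r → Fin n) : b σ α = 0 := by
  induction r with
  | zero =>
    have h := hv fun i => i.elim0
    simp only [Finset.univ_unique, Finset.sum_singleton, Finset.univ_eq_empty, Finset.prod_empty,
      mul_one] at h
    rwa [Subsingleton.elim σ default, Subsingleton.elim α default]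
  | succ r ih =>
    have hu : ∀ (u : Fin n → ℝ) (σ α : Fin r → Fin n),
        ∑ s, ∑ t, u s * u t * b (Fin.cons s σ) (Fin.cons t α) = 0 := by
      intro u
      refine ih (fun σ α => ∑ s, ∑ t, u s * u t * b (Fin.cons s σ) (Fin.cons t α)) ?_ ?_ ?_ ?_
      · intro σ α i j hij
        simp only [← cons_comp_swap_succ, hσ _ _ _ _ ((Fin.succ_injective r).ne hij), mul_neg,
          Finset.sum_neg_distrib]
      · intro σ α i j hij
        simp only [← cons_comp_swap_succ, hα _ _ _ _ ((Fin.succ_injective r).ne hij), mul_neg,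
          Finset.sum_neg_distrib]
      · intro σ α i
        -- The term that exchanges `σ_i` with the leading `t` is antisymmetric in `s` and `t`.
        have hterm : ∀ s t, b (Fin.cons s σ) (Fin.cons t α)
            = b (Fin.cons s (Function.update σ i t)) (Fin.cons (σ i) α)
              + ∑ j, b (Fin.cons s (Function.update σ i (α j)))
                  (Fin.cons t (Function.update α j (σ i))) := by
          intro s t
          rw [hB _ _ i.succ, Fin.sum_univ_succ]
          simp only [Fin.cons_zero, Fin.cons_succ, Fin.cons_update, Fin.update_cons_zero]
        have hanti : ∀ s t, b (Fin.cons s (Function.update σ i t)) (Fin.cons (σ i) α)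
            = -b (Fin.cons t (Function.update σ i s)) (Fin.cons (σ i) α) := by
          intro s t
          rw [← hσ _ _ 0 i.succ (Fin.succ_ne_zero i).symm, cons_comp_swap_zero]
          simp
        have hzero : ∑ s, ∑ t,
            u s * u t * b (Fin.cons s (Function.update σ i t)) (Fin.cons (σ i) α) = 0 := by
          have h : ∑ s, ∑ t, u s * u t * b (Fin.cons s (Function.update σ i t)) (Fin.cons (σ i) α)
              = -∑ s, ∑ t,
                u s * u t * b (Fin.cons s (Function.update σ i t)) (Fin.cons (σ i) α) := by
            conv_rhs => rw [Finset.sum_comm]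
            simp only [← Finset.sum_neg_distrib]
            refine Finset.sum_congr rfl fun s _ => Finset.sum_congr rfl fun t _ => ?_
            rw [hanti]
            ring
          linarith
        conv_lhs =>
          enter [2, s, 2, t]
          rw [hterm, mul_add]
        simp only [Finset.sum_add_distrib, hzero, zero_add, Finset.mul_sum]
        rw [Finset.sum_congr rfl fun (s : Fin n) _ => Finset.sum_comm, Finset.sum_comm]
      · intro v
        have h := hv (Fin.cons u v)
        rw [sum_fin_succ_arrow] at h
        simp only [sum_fin_succ_arrow (F := fun α => b _ α * _), Fin.prod_univ_succ, Fin.cons_zero,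
          Fin.cons_succ] at h
        simp only [Finset.sum_mul]
        rw [Finset.sum_congr rfl fun (σ : Fin r → Fin n) _ => Finset.sum_comm, Finset.sum_comm, ← h]
        refine Finset.sum_congr rfl fun s _ => Finset.sum_congr rfl fun σ _ => ?_
        rw [Finset.sum_comm]
        refine Finset.sum_congr rfl fun t _ => Finset.sum_congr rfl fun α _ => by ring
    have hss : ∀ s σ α, b (Fin.cons s σ) (Fin.cons s α) = 0 := by
      intro s σ α
      have h := hu (unitVec s) σ α
      simpa [Pi.single_apply] using h
    -- Polarization, with `u = e_s + e_t`.
    have hst : ∀ s t σ α, b (Fin.cons s σ) (Fin.cons t α) = -b (Fin.cons t σ) (Fin.cons s α) := by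
      intro s t σ α
      have h := hu (unitVec s + unitVec t) σ α
      simp only [Pi.add_apply, add_mul, mul_add, Finset.sum_add_distrib] at h
      simp only [Pi.single_apply, ite_mul, mul_ite, one_mul, mul_one, zero_mul, mul_zero,
        Finset.sum_ite_eq', Finset.mem_univ, if_true, hss] at h
      linarith
    have hcons : ∀ s t (σ α : Fin r → Fin n), b (Fin.cons s σ) (Fin.cons t α) = 0 := by
      intro s t σ α
      have h := hB (Fin.cons s σ) (Fin.cons t α) 0
      have hj : ∀ j, b (Fin.cons (α j) σ) (Fin.cons t (Function.update α j s))
          = -b (Fin.cons s σ) (Fin.cons t α) := by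
        intro j
        have h1 := hα (Fin.cons (α j) σ) (Fin.cons t (Function.update α j s)) 0 j.succ
          (Fin.succ_ne_zero j).symm
        have h2 := hα (Fin.cons s σ) (Fin.cons t α) 0 j.succ (Fin.succ_ne_zero j).symm
        rw [cons_comp_swap_zero] at h1 h2
        rw [Function.update_self, Function.update_idem] at h1
        linarith [hst (α j) s σ (Function.update α j t)]
      rw [Fin.sum_univ_succ] at h
      simp only [Fin.cons_zero, Fin.cons_succ, Fin.update_cons_zero, ← Fin.cons_update, hj,
        hst t s σ α, Finset.sum_const, Finset.card_univ, Fintype.card_fin, nsmul_eq_mul] at h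
      have hpos : (2 + r : ℝ) * b (Fin.cons s σ) (Fin.cons t α) = 0 := by linarith
      exact (mul_eq_zero.1 hpos).resolve_left (by positivity)
    rw [← Fin.cons_self_tail σ, ← Fin.cons_self_tail α]
    exact hcons _ _ _ _

/-- If all nonzero terms of a vanishing sum are equal, they are zero. -/
theorem eq_zero_of_sum_eq_zero {ι : Type*} [Fintype ι] {f : ι → ℝ} {x : ℝ}
    (hf : ∀ k, f k = 0 ∨ f k = x) {k : ι} (hk : f k = x) (h : ∑ k, f k = 0) : x = 0 := by
  have h1 : ∑ k, f k ^ 2 = 0 := by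
    rw [show ∑ k, f k ^ 2 = x * ∑ k, f k by
      rw [Finset.mul_sum]
      refine Finset.sum_congr rfl fun k _ => ?_
      rcases hf k with h | h <;> rw [h] <;> ring, h, mul_zero]
  have h2 := (Finset.sum_eq_zero_iff_of_nonneg fun k _ => sq_nonneg (f k)).1 h1 k
    (Finset.mem_univ k)
  rw [← hk]
  exact pow_eq_zero_iff (two_ne_zero) |>.1 h2

/-- If the polynomial `∑ b(σ; α) ∏ ψ_{α_i σ_i}` vanishes identically, so does
`b(v_1, …, v_r; v_1, …, v_r)`: this is the value of the polynomial at `ψ = ∑_k v_k ⊙ v_k`, divided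
by `r!`. -/
theorem diagonal_eq_zero_of_sum_eq_zero {r : ℕ} (b : (Fin r → Fin n) → (Fin r → Fin n) → ℝ)
    (hσ : ∀ σ α (P : Equiv.Perm (Fin r)),
      b (σ ∘ P) α = ((Equiv.Perm.sign P : ℤ) : ℝ) * b σ α)
    (hα : ∀ σ α (P : Equiv.Perm (Fin r)),
      b σ (α ∘ P) = ((Equiv.Perm.sign P : ℤ) : ℝ) * b σ α)
    (h : ∀ ψ : Sym2 (Fin n) → ℝ, ∑ σ, ∑ α, b σ α * ∏ i, ψ s(α i, σ i) = 0)
    (v : Fin r → Fin n → ℝ) :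
    ∑ σ, ∑ α, b σ α * ((∏ i, v i (σ i)) * ∏ i, v i (α i)) = 0 := by
  -- The value at `∑_k v_k ⊙ v_k` is `∑_κ B κ`; only permutations `κ` contribute, and equally.
  set B : (Fin r → Fin r) → ℝ := fun κ =>
    ∑ σ, ∑ α, b σ α * ((∏ i, v (κ i) (σ i)) * ∏ i, v (κ i) (α i)) with hBdef
  have hzero : ∀ κ, ¬ Function.Injective κ → B κ = 0 := by
    intro κ hκ
    simp only [Function.Injective, not_forall] at hκ
    obtain ⟨i, j, hij, hne⟩ := hκ
    have hprod : ∀ σ : Fin r → Fin n,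
        ∏ k, v (κ k) ((σ ∘ Equiv.swap i j) k) = ∏ k, v (κ k) (σ k) := by
      intro σ
      rw [← Equiv.prod_comp (Equiv.swap i j) fun k => v (κ k) (σ k)]
      refine Finset.prod_congr rfl fun k _ => ?_
      rw [Function.comp_apply, ← Function.comp_apply (f := κ), comp_swap_eq_self hij]
    have hsum := Equiv.sum_comp (Equiv.arrowCongr (Equiv.swap i j) (Equiv.refl (Fin n)))
      fun σ => ∑ α, b σ α * ((∏ i, v (κ i) (σ i)) * ∏ i, v (κ i) (α i))
    have hcomp : ∀ σ : Fin r → Fin n, (Equiv.arrowCongr (Equiv.swap i j) (Equiv.refl (Fin n))) σ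
        = σ ∘ Equiv.swap i j := fun σ => rfl
    simp only [hcomp, hprod, hσ, Equiv.Perm.sign_swap hne, Units.val_neg, Units.val_one,
      Int.cast_neg, Int.cast_one, neg_mul, one_mul, Finset.sum_neg_distrib] at hsum
    simp only [hBdef]
    linarith
  have hperm : ∀ P : Equiv.Perm (Fin r), B P = B id := by
    intro P
    simp only [hBdef]
    rw [← Equiv.sum_comp (Equiv.arrowCongr P.symm (Equiv.refl (Fin n)))]
    refine Finset.sum_congr rfl fun σ _ => ?_
    rw [← Equiv.sum_comp (Equiv.arrowCongr P.symm (Equiv.refl (Fin n)))]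
    refine Finset.sum_congr rfl fun α _ => ?_
    have hcomp : ∀ σ : Fin r → Fin n, (Equiv.arrowCongr P.symm (Equiv.refl (Fin n))) σ = σ ∘ P :=
      fun σ => rfl
    simp only [hcomp, hσ, hα, Function.comp_apply, id]
    rw [Equiv.prod_comp P fun i => v i (σ i), Equiv.prod_comp P fun i => v i (α i),
      ← mul_assoc _ _ (b σ α), sign_mul_self, one_mul]
  have hsum : ∑ κ, B κ = 0 := by
    rw [← h (∑ k, symMul (v k) (v k))]
    simp only [hBdef]
    rw [Finset.sum_comm]
    refine Finset.sum_congr rfl fun σ _ => ?_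
    rw [Finset.sum_comm]
    refine Finset.sum_congr rfl fun α _ => ?_
    rw [← Finset.mul_sum]
    congr 1
    simp only [Finset.sum_apply, symMul_mk, Finset.prod_univ_sum, Fintype.piFinset_univ]
    refine Finset.sum_congr rfl fun κ _ => ?_
    rw [← Finset.prod_mul_distrib]
    exact Finset.prod_congr rfl fun i _ => by ring
  refine eq_zero_of_sum_eq_zero (f := B) (k := id) (fun κ => ?_) rfl hsum
  by_cases hκ : Function.Injective κ
  · exact Or.inr (hperm (Equiv.ofBijective κ (Finite.injective_iff_bijective.1 hκ)))
  · exact Or.inl (hzero κ hκ)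

/-! ### Uniqueness of the coefficients -/

theorem sum_mul_epsilon_update (f : Fin n → ℝ) (ρ : Fin n → Fin n) (s : Fin n) :
    ∑ j, f (ρ j) * epsilon (Function.update ρ j s) = f s * epsilon ρ := by
  have h : ∑ ζ, f ζ * (∑ j, if ρ j = ζ then epsilon (Function.update ρ j s) else 0)
      = ∑ ζ, f ζ * if s = ζ then epsilon ρ else 0 := by
    simp only [epsilon_exchange]
  simp only [Finset.mul_sum] at h
  rw [Finset.sum_comm] at h
  simpa using h

theorem sum_eq_zero_of_sum_update {m : ℕ} (F : (Fin m → Fin n) → ℝ) (j : Fin m) (ζ₀ : Fin n)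
    (h : ∀ τ, ∑ ζ, F (Function.update τ j ζ) = 0) : ∑ τ, F τ = 0 := by
  rw [← Equiv.sum_comp (Equiv.funSplitAt j (Fin n)).symm, Fintype.sum_prod_type, Finset.sum_comm]
  refine Finset.sum_eq_zero fun τ _ => ?_
  rw [← h ((Equiv.funSplitAt j (Fin n)).symm (ζ₀, τ))]
  refine Finset.sum_congr rfl fun ζ _ => congrArg F (funext fun k => ?_)
  by_cases hk : k = j
  · subst hk; simp
  · simp [hk]

section Coefficients

variable {r : Fin (n + 1)} {d : (Fin (r : ℕ) → Fin n) → (Fin (n - (r : ℕ)) → Fin n) → ℝ}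

/-- The Bianchi identity for the dualized coefficients `∑_τ d^σ_τ ε^{α τ}`: it is the vanishing of
the trace, by Cramer's rule. -/
theorem sum_mul_epsilon_bianchi
    (htr : ∀ σ τ i j, ∑ ζ, d (Function.update σ i ζ) (Function.update τ j ζ) = 0)
    (σ α : Fin (r : ℕ) → Fin n) (i : Fin (r : ℕ)) :
    ∑ τ, d σ τ * epsilon (joinIndices r α τ)
      = ∑ j, ∑ τ, d (Function.update σ i (α j)) τ *
          epsilon (joinIndices r (Function.update α j (σ i)) τ) := by
  have hτ : ∀ τ, d σ τ * epsilon (joinIndices r α τ)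
      = (∑ j, d (Function.update σ i (α j)) τ *
          epsilon (joinIndices r (Function.update α j (σ i)) τ))
        + ∑ j, d (Function.update σ i (τ j)) τ *
          epsilon (joinIndices r α (Function.update τ j (σ i))) := by
    intro τ
    have h := sum_mul_epsilon_update (fun ζ => d (Function.update σ i ζ) τ) (joinIndices r α τ) (σ i)
    rw [Function.update_eq_self] at h
    rw [← h, ← Equiv.sum_comp (splitEquiv r), Fintype.sum_sum_type]
    simp only [joinIndices_splitEquiv_inl, joinIndices_splitEquiv_inr, joinIndices_update_left,
      joinIndices_update_right]
  simp only [hτ, Finset.sum_add_distrib]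
  rw [Finset.sum_comm, add_eq_left, Finset.sum_comm]
  refine Finset.sum_eq_zero fun j _ => ?_
  refine sum_eq_zero_of_sum_update _ j (σ i) fun τ => ?_
  simp only [Function.update_self, Function.update_idem, ← Finset.sum_mul, htr, zero_mul]

/-- Traceless antisymmetric coefficients are determined by the polynomial in the second derivatives
that they define. -/
theorem eq_zero_of_sum_mul_hyperJacobian
    (hanti : ∀ σ τ (P : Equiv.Perm (Fin (r : ℕ))) (Q : Equiv.Perm (Fin (n - (r : ℕ)))),
      d (σ ∘ P) (τ ∘ Q)
        = ((Equiv.Perm.sign P : ℤ) : ℝ) * ((Equiv.Perm.sign Q : ℤ) : ℝ) * d σ τ)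
    (htr : ∀ σ τ i j, ∑ ζ, d (Function.update σ i ζ) (Function.update τ j ζ) = 0)
    (h : ∀ ψ : Sym2 (Fin n) → ℝ, ∑ σ, ∑ τ, d σ τ * hyperJacobian r σ τ (fiberIncl ψ) = 0)
    (σ : Fin (r : ℕ) → Fin n) (τ : Fin (n - (r : ℕ)) → Fin n) : d σ τ = 0 := by
  set b : (Fin (r : ℕ) → Fin n) → (Fin (r : ℕ) → Fin n) → ℝ := fun σ α =>
    ∑ τ, d σ τ * epsilon (joinIndices r α τ) with hb
  have hbσ : ∀ σ α (P : Equiv.Perm (Fin (r : ℕ))),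
      b (σ ∘ P) α = ((Equiv.Perm.sign P : ℤ) : ℝ) * b σ α := by
    intro σ α P
    have hP : ∀ τ, d (σ ∘ P) τ = ((Equiv.Perm.sign P : ℤ) : ℝ) * d σ τ := fun τ => by
      simpa using hanti σ τ P 1
    simp only [hb, hP, Finset.mul_sum, mul_assoc]
  have hbα : ∀ σ α (P : Equiv.Perm (Fin (r : ℕ))),
      b σ (α ∘ P) = ((Equiv.Perm.sign P : ℤ) : ℝ) * b σ α := by
    intro σ α P
    simp only [hb, epsilon_joinIndices_comp_left, Finset.mul_sum, mul_left_comm]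
  have hpoly : ∀ ψ : Sym2 (Fin n) → ℝ, ∑ σ, ∑ α, b σ α * ∏ i, ψ s(α i, σ i) = 0 := by
    intro ψ
    rw [← h ψ]
    refine Finset.sum_congr rfl fun σ _ => ?_
    simp only [hb, hyperJacobian, Finset.sum_mul, Finset.mul_sum]
    rw [Finset.sum_comm]
    exact Finset.sum_congr rfl fun τ _ => Finset.sum_congr rfl fun α _ => mul_assoc _ _ _
  have hswap : ∀ {i j : Fin (r : ℕ)}, i ≠ j → ∀ x : ℝ,
      ((Equiv.Perm.sign (Equiv.swap i j) : ℤ) : ℝ) * x = -x := fun hij x => by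
    simp [Equiv.Perm.sign_swap hij]
  have hbzero : ∀ σ α, b σ α = 0 := eq_zero_of_bianchi b
    (fun σ α i j hij => by rw [hbσ, hswap hij]) (fun σ α i j hij => by rw [hbα, hswap hij])
    (fun σ α i => sum_mul_epsilon_bianchi htr σ α i)
    (diagonal_eq_zero_of_sum_eq_zero b hbσ hbα hpoly)
  by_cases hτ : Function.Injective τ
  · -- Contract `b` with the complementary indices `α` of `τ`: all nonzero terms `τ'` of the sum
    -- `b σ α` are rearrangements of `τ`, and contribute equally.
    obtain ⟨π, hπ⟩ := exists_perm_comp_eq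
      ((splitEquiv r).injective.comp Sum.inr_injective) hτ
    set α : Fin (r : ℕ) → Fin n := π ∘ splitEquiv r ∘ Sum.inl with hα
    have hε : Function.Injective (joinIndices r α τ) := by
      rw [hα, hπ, joinIndices_comp, joinIndices_splitEquiv]
      exact π.injective
    have hx : d σ τ * epsilon (joinIndices r α τ) = 0 := by
      refine eq_zero_of_sum_eq_zero (f := fun τ => d σ τ * epsilon (joinIndices r α τ)) (k := τ)
        (fun τ' => ?_) rfl (hbzero σ α)
      by_cases hτ' : Function.Injective (joinIndices r α τ')
      · obtain ⟨Q, rfl⟩ := exists_perm_of_joinIndices_right hτ' hε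
        right
        have h1 := hanti σ τ 1 Q
        have h2 := epsilon_joinIndices_comp r α τ 1 Q
        simp only [Equiv.Perm.coe_one, Function.comp_id, Equiv.Perm.sign_one, Units.val_one,
          Int.cast_one, one_mul] at h1 h2
        rw [h1, h2, mul_mul_mul_comm, sign_mul_self, one_mul]
      · left
        rw [epsilon_eq_zero hτ', mul_zero]
    exact (mul_eq_zero.1 hx).resolve_right (epsilon_ne_zero_iff.2 hε)
  · simp only [Function.Injective, not_forall] at hτ
    obtain ⟨i, j, hij, hne⟩ := hτ
    have h1 := hanti σ τ 1 (Equiv.swap i j)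
    rw [comp_swap_eq_self hij] at h1
    simp only [Equiv.Perm.coe_one, Function.comp_id, Equiv.Perm.sign_one, Units.val_one,
      Int.cast_one, one_mul, Equiv.Perm.sign_swap hne, Units.val_neg, Int.cast_neg] at h1
    linarith

end Coefficients

theorem hyperJacobian_smul (r : Fin (n + 1)) (σ : Fin (r : ℕ) → Fin n)
    (τ : Fin (n - (r : ℕ)) → Fin n) (t : ℝ) (ψ : Sym2 (Fin n) → ℝ) :
    hyperJacobian r σ τ (fiberIncl (t • ψ)) = t ^ (r : ℕ) * hyperJacobian r σ τ (fiberIncl ψ) := by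
  simp only [hyperJacobian, psi2, fiberIncl_apply, Pi.smul_apply, smul_eq_mul,
    Finset.prod_mul_distrib, Finset.prod_const, Finset.card_univ, Fintype.card_fin, Finset.mul_sum,
    mul_left_comm]

theorem eq_zero_of_sum_pow_mul {N : ℕ} {a : Fin N → ℝ}
    (h : ∀ t : ℝ, ∑ r : Fin N, t ^ (r : ℕ) * a r = 0) (r : Fin N) : a r = 0 := by
  have hp : (∑ r : Fin N, Polynomial.C (a r) * Polynomial.X ^ (r : ℕ) : Polynomial ℝ) = 0 := by
    refine Polynomial.funext fun t => ?_
    rw [Polynomial.eval_finsetSum, Polynomial.eval_zero, ← h t]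
    refine Finset.sum_congr rfl fun r _ => ?_
    simp only [Polynomial.eval_mul, Polynomial.eval_C, Polynomial.eval_pow, Polynomial.eval_X]
    ring
  have hc := congrArg (fun q : Polynomial ℝ => q.coeff r) hp
  simpa [Polynomial.finsetSum_coeff, Polynomial.coeff_X_pow, Fin.val_inj] using hc

/-- The trace over any upper index and any lower index vanishes. -/
theorem IsAdmissible.sum_update_eq_zero {V : Set ((Fin n → ℝ) × ℝ)} {c : CoefficientFamily n}
    (hc : IsAdmissible V c) {p : Jet2 n} (hp : p ∈ jetDomain V) {r : Fin (n + 1)}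
    (σ : Fin (r : ℕ) → Fin n) (τ : Fin (n - (r : ℕ)) → Fin n) (i : Fin (r : ℕ))
    (j : Fin (n - (r : ℕ))) :
    ∑ ζ, c r (Function.update σ i ζ) (Function.update τ j ζ) p = 0 := by
  have hi := i.2
  have hj := j.2
  obtain ⟨i', hi'⟩ : ∃ i' : Fin (r : ℕ), (i' : ℕ) + 1 = r := ⟨⟨r - 1, by omega⟩, by simp; omega⟩
  obtain ⟨j', hj'⟩ : ∃ j' : Fin (n - (r : ℕ)), (j' : ℕ) + 1 = n - r :=
    ⟨⟨n - r - 1, by omega⟩, by simp; omega⟩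
  have hcomp : ∀ {m : ℕ} (σ : Fin m → Fin n) (i i' : Fin m) (ζ : Fin n), Function.update σ i ζ
      = Function.update (σ ∘ Equiv.swap i i') i' ζ ∘ Equiv.swap i i' := by
    intro m σ i i' ζ
    rw [Function.update_comp_equiv, Function.comp_assoc]
    simp [← Equiv.coe_trans]
  have h := hc.traceless r (σ ∘ Equiv.swap i i') (τ ∘ Equiv.swap j j') i' j' hi' hj' p hp
  simp only [hcomp σ i i', hcomp τ j j', hc.antisymmetric _ _ _ _ _ p hp, ← Finset.mul_sum, h,
    mul_zero]

/-- The coefficients of an admissible expansion are determined by the function. -/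
theorem IsAdmissible.eqOn {V : Set ((Fin n → ℝ) × ℝ)} (hV : IsOpen V) {L : Jet2 n → ℝ}
    {c c' : CoefficientFamily n} (hc : IsAdmissible V c) (h : IsExpansion V L c)
    (hc' : IsAdmissible V c') (h' : IsExpansion V L c') (r : Fin (n + 1))
    (σ : Fin (r : ℕ) → Fin n) (τ : Fin (n - (r : ℕ)) → Fin n) :
    Set.EqOn (c r σ τ) (c' r σ τ) (jetDomain V) := by
  intro p hp
  have hsum : ∀ ψ : Sym2 (Fin n) → ℝ, ∑ r : Fin (n + 1), ∑ σ : Fin (r : ℕ) → Fin n,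
      ∑ τ : Fin (n - (r : ℕ)) → Fin n,
        (c r σ τ p - c' r σ τ p) * hyperJacobian r σ τ (fiberIncl ψ) = 0 := by
    intro ψ
    have hJ : ∀ (r : Fin (n + 1)) (σ : Fin (r : ℕ) → Fin n) (τ : Fin (n - (r : ℕ)) → Fin n),
        hyperJacobian r σ τ (p + fiberIncl (ψ - p.2.2)) = hyperJacobian r σ τ (fiberIncl ψ) := by
      intro r σ τ
      simp [hyperJacobian, psi2, fiberIncl_apply]
    have hq := add_fiberIncl_mem hp (ψ - p.2.2)
    have h1 := h _ hq
    have h2 := h' _ hq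
    simp only [hJ, hc.apply_add_fiberIncl hV _ _ _ hp] at h1
    simp only [hJ, hc'.apply_add_fiberIncl hV _ _ _ hp] at h2
    simp only [sub_mul, Finset.sum_sub_distrib]
    rw [← h1, ← h2, sub_self]
  have hr : ∀ (r : Fin (n + 1)) (ψ : Sym2 (Fin n) → ℝ), ∑ σ : Fin (r : ℕ) → Fin n,
      ∑ τ : Fin (n - (r : ℕ)) → Fin n,
        (c r σ τ p - c' r σ τ p) * hyperJacobian r σ τ (fiberIncl ψ) = 0 := by
    intro r ψ
    refine eq_zero_of_sum_pow_mul (a := fun r : Fin (n + 1) => ∑ σ : Fin (r : ℕ) → Fin n,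
      ∑ τ : Fin (n - (r : ℕ)) → Fin n,
        (c r σ τ p - c' r σ τ p) * hyperJacobian r σ τ (fiberIncl ψ)) (fun t => ?_) r
    rw [← hsum (t • ψ)]
    simp only [hyperJacobian_smul, Finset.mul_sum, mul_left_comm]
  refine sub_eq_zero.1 (eq_zero_of_sum_mul_hyperJacobian
    (d := fun σ τ => c r σ τ p - c' r σ τ p) ?_ ?_ (hr r) σ τ)
  · intro σ τ P Q
    simp only [hc.antisymmetric _ _ _ _ _ p hp, hc'.antisymmetric _ _ _ _ _ p hp, mul_sub]
  · intro σ τ i j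
    simp only [Finset.sum_sub_distrib, hc.sum_update_eq_zero hp, hc'.sum_update_eq_zero hp, sub_zero]

end

end TrivialLagrangian

theorem theorem1 (n : ℕ) (V : Set ((Fin n → ℝ) × ℝ)) (hV : IsOpen V)
    (L : TrivialLagrangian.Jet2 n → ℝ)
    (hL : ContDiffOn ℝ ∞ L (TrivialLagrangian.jetDomain V)) :
    (TrivialLagrangian.SolvesTrivialityEquation V L ↔
      ∃ c : TrivialLagrangian.CoefficientFamily n,
        TrivialLagrangian.IsAdmissible V c ∧ TrivialLagrangian.IsExpansion V L c) ∧
    (∀ c c' : TrivialLagrangian.CoefficientFamily n,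
      TrivialLagrangian.IsAdmissible V c → TrivialLagrangian.IsExpansion V L c →
      TrivialLagrangian.IsAdmissible V c' → TrivialLagrangian.IsExpansion V L c' →
      ∀ r σ τ, Set.EqOn (c r σ τ) (c' r σ τ) (TrivialLagrangian.jetDomain V)) :=
  ⟨⟨fun h => ⟨TrivialLagrangian.expansionCoeff L,
      TrivialLagrangian.isAdmissible_expansionCoeff hV hL,
      TrivialLagrangian.isExpansion_expansionCoeff hV hL h⟩,
    fun ⟨_, hc, h⟩ => h.solvesTrivialityEquation hV hL hc⟩,
    fun _ _ hc h hc' h' => hc.eqOn hV h hc' h'⟩
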